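/- Let $d\ge 1$ and let $P$ be a probability measure on $\mathbb{R}^d$ with Lebesgue density $p\colon\mathbb{R}^d\to[0,\infty)$, where $p\in W^{2,1}(\mathbb{R}^d)\cap W^{2,2}(\mathbb{R}^d)$, i.e. $p$ and its weak derivatives up to order $2$ are integrable and square-integrable. Let $K\colon\mathbb{R}^d\to[0,\infty)$ belong to $L^1(\mathbb{R}^d)\cap L^2(\mathbb{R}^d)$ with \[ \int K(u)\,du=1,\qquad \int u\,K(u)\,du=0,\qquad \int\|u\|^2K(u)\,du<\infty , \] and let $h=h_N>0$ be bandwidths with $h_N\to0$ and $Nh_N^d\to\infty$ as $N\to\infty$. Let $(Z_k)_{k\ge1}$ be random variables in $\mathbb{R}^d$ that are either i.i.d. with law $P$, or form a stationary Markov chain with invariant distribution $P$ and transition kernel $\kappa$ whose spectral gap $\gamma$ or pseudo spectral gap $\gamma_{\mathrm{ps}}$ is positive. Here $Tf(x)=\int f(y)\,\kappa(x,dy)$ is the Markov operator on the complex space $L^2_0(P)=\{f\in L^2(P):\int f\,dP=0\}$, $\gamma=\gamma(T)$ and \[ \gamma(A)=1-\sup\{\operatorname{Re}\lambda:\lambda\in\operatorname{spec}(A\text{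 on }L^2_0(P))\}, \qquad \gamma_{\mathrm{ps}}=\sup_{k\ge1}\frac{\gamma\big((T^*)^kT^k\big)}{k}. \] Let $\hat q_N(x)=\frac1N\sum_{k=1}^N h_N^{-d}K\big((Z_k-x)/h_N\big)$ and \[ \mathrm{MIAE}(\hat q_N)=\mathbb{E}\int_{\mathbb{R}^d}|\hat q_N(x)-p(x)|\,dx,\qquad \mathrm{MISE}(\hat q_N)=\mathbb{E}\int_{\mathbb{R}^d}(\hat q_N(x)-p(x))^2\,dx . \] For the $\mathrm{MIAE}$ bounds (and only for these) assume in addition the tail condition that, for some constants $C_p>0$ and $m>2d$, \[ \int_{\mathbb{R}^d}(1+\|u\|)^mK(u)^2\,du<\infty \quad\text{and}\quad p(x)\le C_p(1+\|x\|)^{-m}\ \text{ for all }x\in\mathbb{R}^d . \] Then, as $N\to\infty$, \[ \mathrm{MIAE}(\hat q_N)=\mathcal O\Big(\frac1{\sqrt{Nh_N^d}}+h_N^2\Big),\qquad \mathrm{MISE}(\hat q_N)=\mathcal O\Big(\frac1{Nh_N^d}+h_N^4\Big). \] If $h_N\asymp N^{-1/(d+4)}$, then \[ \mathrm{MIAE}(\hat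 q_N)=\mathcal O\big(N^{-2/(d+4)}\big),\qquad \mathrm{MISE}(\hat q_N)=\mathcal O\big(N^{-4/(d+4)}\big). \] This choice of bandwidth is asymptotically optimal for the two bounds: for every positive sequence $(b_N)$, the quantities $(Nb_N^d)^{-1/2}+b_N^2$ and $(Nb_N^d)^{-1}+b_N^4$ are bounded below by positive constant multiples of $N^{-2/(d+4)}$ and $N^{-4/(d+4)}$, respectively, for all large $N$, and each of them attains the corresponding order if and only if $b_N\asymp N^{-1/(d+4)}$. -/

import Mathlib

open MeasureTheory ProbabilityTheory Filter Topology
open scoped ENNReal NNReal InnerProductSpace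

noncomputable section

namespace KDE

/-! ### The Markov operator of a transition kernel on `L²(P)` and its spectral gaps -/

section MarkovOperator

variable {α : Type*} [MeasurableSpace α]

theorem ae_ae_of_invariant {κ : Kernel α α} {P : Measure α} (hκ : κ.Invariant P)
    {q : α → Prop} (hq : ∀ᵐ y ∂P, q y) : ∀ᵐ x ∂P, ∀ᵐ y ∂(κ x), q y := by
  refine Measure.ae_ae_of_ae_bind κ.measurable.aemeasurable ?_
  rwa [hκ.def]

theorem integrable_ae_of_invariant {κ : Kernel α α} [IsMarkovKernel κ] {P : Measure α}
    [IsProbabilityMeasure P] (hκ : κ.Invariant P) (f : Lp ℂ 2 P) :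
    ∀ᵐ x ∂P, Integrable f (κ x) := by
  have h1 : Integrable f (P.bind κ) := by
    rw [hκ.def]
    exact (Lp.memLp f).integrable one_le_two
  exact ((Measure.integrable_comp_iff h1.aestronglyMeasurable).1 h1).1

theorem eLpNorm_kernel_integral_le {κ : Kernel α α} [IsMarkovKernel κ] {P : Measure α}
    (hκ : κ.Invariant P) (f : Lp ℂ 2 P) :
    eLpNorm (fun x => ∫ y, f y ∂(κ x)) 2 P ≤ eLpNorm f 2 P := by
  have hf := (Lp.stronglyMeasurable f)
  rw [eLpNorm_eq_lintegral_rpow_enorm_toReal (by simp) (by simp),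
    eLpNorm_eq_lintegral_rpow_enorm_toReal (by simp) (by simp)]
  refine ENNReal.rpow_le_rpow ?_ (by positivity)
  have e : ∫⁻ y, ‖f y‖ₑ ^ (2 : ℝ≥0∞).toReal ∂P
      = ∫⁻ x, ∫⁻ y, ‖f y‖ₑ ^ (2 : ℝ≥0∞).toReal ∂(κ x) ∂P := by
    have h0 := Measure.lintegral_bind (m := P) κ.measurable.aemeasurable
      (hf.measurable.enorm.pow_const (2 : ℝ≥0∞).toReal).aemeasurable
    rwa [hκ.def] at h0
  rw [e]
  refine lintegral_mono fun x => ?_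
  have h1 : ‖∫ y, f y ∂(κ x)‖ₑ ≤ eLpNorm f 2 (κ x) :=
    calc ‖∫ y, f y ∂(κ x)‖ₑ ≤ eLpNorm f 1 (κ x) := by
          rw [eLpNorm_one_eq_lintegral_enorm]; exact enorm_integral_le_lintegral_enorm _
      _ ≤ eLpNorm f 2 (κ x) :=
          eLpNorm_le_eLpNorm_of_exponent_le one_le_two hf.aestronglyMeasurable
  calc ‖∫ y, f y ∂(κ x)‖ₑ ^ (2 : ℝ≥0∞).toReal
      ≤ (eLpNorm f 2 (κ x)) ^ (2 : ℝ≥0∞).toReal := by gcongr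
    _ = _ := by
      rw [eLpNorm_eq_lintegral_rpow_enorm_toReal (by simp) (by simp), ← ENNReal.rpow_mul]
      simp

theorem memLp_kernel_integral {κ : Kernel α α} [IsMarkovKernel κ] {P : Measure α}
    (hκ : κ.Invariant P) (f : Lp ℂ 2 P) :
    MemLp (fun x => ∫ y, f y ∂(κ x)) 2 P :=
  ⟨((Lp.stronglyMeasurable f).integral_kernel (κ := κ)).aestronglyMeasurable,
    (eLpNorm_kernel_integral_le hκ f).trans_lt (Lp.memLp f).2⟩

/-- The Markov operator `(T f)(x) = ∫ f(y) κ(x, dy)` on the complex Hilbert space `L²(P)`, for a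
Markov kernel `κ` with invariant distribution `P`. -/
def markovOp (κ : Kernel α α) [IsMarkovKernel κ] (P : Measure α) [IsProbabilityMeasure P]
    (hκ : κ.Invariant P) : Lp ℂ 2 P →L[ℂ] Lp ℂ 2 P :=
  LinearMap.mkContinuous
    { toFun := fun f => (memLp_kernel_integral hκ f).toLp _
      map_add' := by
        intro f g
        rw [← MemLp.toLp_add]
        refine MemLp.toLp_congr _ _ ?_
        filter_upwards [ae_ae_of_invariant hκ (Lp.coeFn_add f g),
          integrable_ae_of_invariant hκ f, integrable_ae_of_invariant hκ g] with x h1 h2 h3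
        rw [integral_congr_ae h1]
        exact integral_add h2 h3
      map_smul' := by
        intro c f
        rw [RingHom.id_apply, ← MemLp.toLp_const_smul]
        refine MemLp.toLp_congr _ _ ?_
        filter_upwards [ae_ae_of_invariant hκ (Lp.coeFn_smul c f)] with x h1
        rw [integral_congr_ae h1]
        exact integral_smul c _ }
    1 (by
      intro f
      rw [one_mul]
      simp only [LinearMap.coe_mk, AddHom.coe_mk]
      rw [Lp.norm_toLp, Lp.norm_def]
      exact ENNReal.toReal_mono (Lp.eLpNorm_ne_top f) (eLpNorm_kernel_integral_le hκ f))

theorem markovOp_coeFn (κ : Kernel α α) [IsMarkovKernel κ] (P : Measure α)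
    [IsProbabilityMeasure P] (hκ : κ.Invariant P) (f : Lp ℂ 2 P) :
    markovOp κ P hκ f =ᵐ[P] fun x => ∫ y, f y ∂(κ x) :=
  MemLp.coeFn_toLp (memLp_kernel_integral hκ f)

/-- `L²₀(P)`: the orthogonal complement of the constants in `L²(P)`, i.e. the functions of mean
zero (see `mem_L20_iff`). -/
abbrev L20 (P : Measure α) [IsProbabilityMeasure P] : Submodule ℂ (Lp ℂ 2 P) :=
  (ℂ ∙ indicatorConstLp (p := 2) (μ := P) MeasurableSet.univ (measure_ne_top P _) (1 : ℂ))ᗮ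

theorem mem_L20_iff (P : Measure α) [IsProbabilityMeasure P] (f : Lp ℂ 2 P) :
    f ∈ L20 P ↔ ∫ x, f x ∂P = 0 := by
  rw [Submodule.mem_orthogonal_singleton_iff_inner_right, L2.inner_indicatorConstLp_one,
    setIntegral_univ]

theorem markovOp_mem_L20 (κ : Kernel α α) [IsMarkovKernel κ] (P : Measure α)
    [IsProbabilityMeasure P] (hκ : κ.Invariant P) (f : L20 P) :
    markovOp κ P hκ f ∈ L20 P := by
  have hf := (mem_L20_iff P f).1 f.2
  rw [mem_L20_iff, integral_congr_ae (markovOp_coeFn κ P hκ f)]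
  have h1 : Integrable (f : Lp ℂ 2 P) (P.bind κ) := by
    rw [hκ.def]
    exact (Lp.memLp (f : Lp ℂ 2 P)).integrable one_le_two
  have e : (κ ∘ₖ Kernel.const Unit P) () = P.bind κ := by
    rw [Kernel.comp_apply, Kernel.const_apply]
  have h2 := Kernel.integral_comp (κ := Kernel.const Unit P) (η := κ) (a := ()) (e ▸ h1)
  rw [e, hκ.def, hf, Kernel.const_apply] at h2
  exact h2.symm

/-- The Markov operator restricted to the mean-zero functions `L²₀(P)`. -/
def markovOp0 (κ : Kernel α α) [IsMarkovKernel κ] (P : Measure α) [IsProbabilityMeasure P]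
    (hκ : κ.Invariant P) : L20 P →L[ℂ] L20 P :=
  ((markovOp κ P hκ).comp (L20 P).subtypeL).codRestrict (L20 P) (markovOp_mem_L20 κ P hκ)

/-- For an operator `A` on the mean-zero functions, `1 - sup {Re λ : λ ∈ spectrum A}`. When `A` is
self-adjoint the spectrum is real. -/
def opGap {P : Measure α} [IsProbabilityMeasure P] (A : L20 P →L[ℂ] L20 P) : ℝ :=
  1 - sSup (Complex.re '' spectrum ℂ A)

/-- The spectral gap `γ` of the transition kernel `κ` with invariant distribution `P`. Restricting
to `L²₀(P)` takes out the trivial eigenvalue `1` once, so `γ = 0` if it is not simple. -/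
def spectralGap (κ : Kernel α α) [IsMarkovKernel κ] (P : Measure α) [IsProbabilityMeasure P]
    (hκ : κ.Invariant P) : ℝ :=
  opGap (markovOp0 κ P hκ)

/-- The pseudo spectral gap `γ_ps = sup_{k ≥ 1} γ((T*)ᵏ Tᵏ) / k`. -/
def pseudoSpectralGap (κ : Kernel α α) [IsMarkovKernel κ] (P : Measure α)
    [IsProbabilityMeasure P] (hκ : κ.Invariant P) : ℝ :=
  ⨆ k : ℕ, opGap ((ContinuousLinearMap.adjoint (markovOp0 κ P hκ)) ^ (k + 1) *
    (markovOp0 κ P hκ) ^ (k + 1)) / ((k : ℝ) + 1)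

end MarkovOperator

/-! ### The two sampling schemes -/

section Sampling

variable {Ω α : Type*} [MeasurableSpace Ω] [MeasurableSpace α]

/-- `Z 0, Z 1, …` are i.i.d. samples from `P`. -/
structure IsIIDSample (μ : Measure Ω) (P : Measure α) (Z : ℕ → Ω → α) : Prop where
  measurable : ∀ k, Measurable (Z k)
  indep : iIndepFun Z μ
  law : ∀ k, μ.map (Z k) = P

/-- `Z 0, Z 1, …` is a time-homogeneous Markov chain with transition kernel `κ` that is started
in `P`: the conditional distribution of `Z (n + 1)` given `Z 0, …, Z n` is `κ (Z n, ·)`. It is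
stationary when `P` is invariant for `κ`. -/
structure IsMarkovChainFrom (μ : Measure Ω) (P : Measure α) (κ : Kernel α α)
    (Z : ℕ → Ω → α) : Prop where
  measurable : ∀ k, Measurable (Z k)
  initial : μ.map (Z 0) = P
  markov : ∀ n : ℕ,
    μ.map (fun ω => ((fun i : Fin (n + 1) => Z i ω), Z (n + 1) ω)) =
      (μ.map (fun ω => (fun i : Fin (n + 1) => Z i ω))) ⊗ₘ
        (κ.comap (fun z : Fin (n + 1) → α => z (Fin.last n)) (measurable_pi_apply _))

/-- `Z` is either an i.i.d. sequence with law `P`, or a stationary Markov chain with invariant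
distribution `P` and positive spectral gap or positive pseudo spectral gap. -/
def IsIIDOrStationaryWithGap (μ : Measure Ω) (P : Measure α) [IsProbabilityMeasure P]
    (Z : ℕ → Ω → α) : Prop :=
  IsIIDSample μ P Z ∨
    ∃ (κ : Kernel α α) (_ : IsMarkovKernel κ) (hκ : κ.Invariant P),
      IsMarkovChainFrom μ P κ Z ∧
        (0 < spectralGap κ P hκ ∨ 0 < pseudoSpectralGap κ P hκ)

end Sampling

/-! ### Sobolev spaces, the kernel density estimator and its errors -/

/-- `f ∈ W^{k,q}(ℝᵈ)`: `f` and its weak partial derivatives up to order `k` lie in `L^q`. The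
`n`-th order partial derivative in the coordinate directions `a 0, …, a (n - 1)` is tested against
smooth compactly supported functions. -/
def MemSobolev {d : ℕ} (k : ℕ) (q : ℝ≥0∞) (f : EuclideanSpace ℝ (Fin d) → ℝ) : Prop :=
  MemLp f q volume ∧
    ∀ n ≤ k, ∀ a : Fin n → Fin d, ∃ g : EuclideanSpace ℝ (Fin d) → ℝ, MemLp g q volume ∧
      ∀ φ : EuclideanSpace ℝ (Fin d) → ℝ, ContDiff ℝ ((⊤ : ℕ∞) : WithTop ℕ∞) φ → HasCompactSupport φ →
        ∫ x, f x * iteratedFDeriv ℝ n φ x (fun j => EuclideanSpace.single (a j) (1 : ℝ)) =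
          (-1) ^ n * ∫ x, g x * φ x

/-- The assumptions on kernel, bandwidth and density. -/
structure Assumptions {d : ℕ} (K : EuclideanSpace ℝ (Fin d) → ℝ) (h : ℕ → ℝ)
    (p : EuclideanSpace ℝ (Fin d) → ℝ) : Prop where
  K_nonneg : ∀ u, 0 ≤ K u
  K_L1 : MemLp K 1 volume
  K_L2 : MemLp K 2 volume
  K_mass : ∫ u, K u = 1
  K_first_moment : ∫ u, K u • u = 0
  K_second_moment : Integrable (fun u => ‖u‖ ^ 2 * |K u|)
  h_pos : ∀ N, 0 < h N
  h_tendsto : Tendsto h atTop (𝓝 0)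
  Nh_tendsto : Tendsto (fun N : ℕ => (N : ℝ) * h N ^ d) atTop atTop
  p_sobolev_one : MemSobolev 2 1 p
  p_sobolev_two : MemSobolev 2 2 p

/-- The polynomial tail condition on `p` together with the weighted moment condition on `K`. -/
def TailCondition {d : ℕ} (K p : EuclideanSpace ℝ (Fin d) → ℝ) : Prop :=
  ∃ C m : ℝ, 0 < C ∧ 2 * (d : ℝ) < m ∧
    Integrable (fun u => (1 + ‖u‖) ^ m * K u ^ 2) ∧
    ∀ x, p x ≤ C * (1 + ‖x‖) ^ (-m)

/-- `K_h(x, y) = h⁻ᵈ K((x - y) / h)`. -/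
def scaledKernel {d : ℕ} (K : EuclideanSpace ℝ (Fin d) → ℝ) (h : ℝ)
    (x y : EuclideanSpace ℝ (Fin d)) : ℝ :=
  1 / h ^ d * K (h⁻¹ • (x - y))

/-- The kernel density estimator built from the `N` samples `Z 0, …, Z (N - 1)`. -/
def kde {Ω : Type*} {d : ℕ} (K : EuclideanSpace ℝ (Fin d) → ℝ) (h : ℝ)
    (Z : ℕ → Ω → EuclideanSpace ℝ (Fin d)) (N : ℕ) (ω : Ω) (x : EuclideanSpace ℝ (Fin d)) : ℝ :=
  1 / (N : ℝ) * ∑ k ∈ Finset.range N, scaledKernel K h (Z k ω) x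

/-- The mean integrated absolute error of a random density `q`, as an extended real. -/
def MIAE {Ω : Type*} [MeasurableSpace Ω] {d : ℕ} (μ : Measure Ω)
    (q : Ω → EuclideanSpace ℝ (Fin d) → ℝ) (p : EuclideanSpace ℝ (Fin d) → ℝ) : ℝ≥0∞ :=
  ∫⁻ ω, (∫⁻ x, ENNReal.ofReal |q ω x - p x| ∂volume) ∂μ

/-- The mean integrated squared error of a random density `q`, as an extended real. -/
def MISE {Ω : Type*} [MeasurableSpace Ω] {d : ℕ} (μ : Measure Ω)
    (q : Ω → EuclideanSpace ℝ (Fin d) → ℝ) (p : EuclideanSpace ℝ (Fin d) → ℝ) : ℝ≥0∞ :=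
  ∫⁻ ω, (∫⁻ x, ENNReal.ofReal ((q ω x - p x) ^ 2) ∂volume) ∂μ

/-- `a N = O(b N)` as `N → ∞` for a sequence of extended nonnegative numbers; in particular `a N`
is finite for large `N`. -/
def IsBigOSeq (a : ℕ → ℝ≥0∞) (b : ℕ → ℝ) : Prop :=
  ∃ C : ℝ, ∀ᶠ N in atTop, a N ≤ ENNReal.ofReal (C * b N)

/-- The bound `1 / √(N hᵈ) + h²` for the MIAE. -/
def absBound (d : ℕ) (h : ℕ → ℝ) (N : ℕ) : ℝ := 1 / √((N : ℝ) * h N ^ d) + h N ^ 2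

/-- The bound `1 / (N hᵈ) + h⁴` for the MISE. -/
def sqBound (d : ℕ) (h : ℕ → ℝ) (N : ℕ) : ℝ := 1 / ((N : ℝ) * h N ^ d) + h N ^ 4

end KDE

end

/-!
Write `m = smoothing K p h` for the mean of the estimator `kde K h Z N`; its error splits into the
stochastic part `kde - m` and the bias `m - p`.

Bias. A second-order Taylor expansion of `p` in direction `h u`, averaged against `K u du`, loses
its constant and linear terms to the two moment conditions. The remainder is an average of
translates of second weak derivatives of `p`, so by Jensen's inequality and translation invariance
its `L^q` norm is `O(h²)` as soon as `p ∈ W^{2,q}`.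

Stochastic part. Either form of gap makes `1 - T` invertible on `L²₀(P)`, where `T` is a
contraction, so the sums `1 + T + ⋯ + T^(n-1) = (1 - T^n) (1 - T)⁻¹` are bounded uniformly in `n`.
They collect the correlations of the chain, so that the variance of `f (Z 0) + ⋯ + f (Z (N - 1))`
is at most a constant times `N ∫ f² dP`, as in the independent case. For `f = scaledKernel K h · x`
this bounds `𝔼 (kde - m)²` at `x` by a constant times `(N hᵈ)⁻¹ ∫ K(u)² p(x + h u) du`. Integrating
over `x` gives the squared error. For the absolute error one first applies the Cauchy–Schwarz
inequality with the weight `(1 + ‖x‖)ˢ`, where `d < s`: it is submultiplicative, so under the tail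
condition it can be distributed over `K²` and `p` when `s` is half the tail exponent.

Optimality. At the bandwidth `t N^(-1/(d+4))` the two bounds are `N^(-2/(d+4))` and
`N^(-4/(d+4))` times functions of `t` that are bounded below and tend to infinity as `t → 0` and as
`t → ∞`.
-/

noncomputable section

namespace KDE

/-! ### Powers of contractions and the spectrum -/

section Spectrum

theorem re_lt_of_mem_spectrum {A : Type*} [NormedRing A] [NormedAlgebra ℂ A] [CompleteSpace A]
    {a : A} {c : ℝ} (hc : sSup (Complex.re '' spectrum ℂ a) < c) {z : ℂ} (hz : z ∈ spectrum ℂ a) :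
    z.re < c :=
  (le_csSup ((spectrum.isCompact a).image Complex.continuous_re).bddAbove
    (Set.mem_image_of_mem _ hz)).trans_lt hc

theorem isUnit_one_sub_of_sSup_re_spectrum_lt_one {A : Type*} [NormedRing A] [NormedAlgebra ℂ A]
    [CompleteSpace A] {a : A} (ha : sSup (Complex.re '' spectrum ℂ a) < 1) : IsUnit (1 - a) := by
  by_contra h
  have h_one : (1 : ℂ) ∈ spectrum ℂ a := by rwa [spectrum.mem_iff, map_one]
  simpa using re_lt_of_mem_spectrum ha h_one

theorem norm_lt_one_of_sSup_re_spectrum_star_mul_self_lt_one {A : Type*} [CStarAlgebra A]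
    [PartialOrder A] [StarOrderedRing A] {a : A}
    (ha : sSup (Complex.re '' spectrum ℂ (star a * a)) < 1) : ‖a‖ < 1 := by
  rcases subsingleton_or_nontrivial A with _ | _
  · rw [Subsingleton.elim a 0, norm_zero]
    exact one_pos
  · have h_mem : ((‖star a * a‖ : ℝ) : ℂ) ∈ spectrum ℂ (star a * a) :=
      spectrum.algebraMap_mem ℂ
        (CStarAlgebra.norm_mem_spectrum_of_nonneg (ha := star_mul_self_nonneg a))
    have h_lt := re_lt_of_mem_spectrum ha h_mem
    rw [Complex.ofReal_re, CStarRing.norm_star_mul_self] at h_lt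
    nlinarith [norm_nonneg a]

theorem isUnit_one_sub_of_isUnit_one_sub_pow {R : Type*} [Ring R] {a : R} {n : ℕ}
    (h : IsUnit (1 - a ^ n)) : IsUnit (1 - a) := by
  have h_comm : Commute (1 - a) (∑ i ∈ Finset.range n, a ^ i) :=
    Commute.sum_right _ _ _ fun i _ => (Commute.one_left _).sub_left (Commute.self_pow a i)
  rw [← mul_neg_geom_sum] at h
  exact (h_comm.isUnit_mul_iff.1 h).1

theorem isUnit_one_sub_of_sSup_re_spectrum_adjoint_pow_mul_pow_lt_one {H : Type*}
    [NormedAddCommGroup H] [InnerProductSpace ℂ H] [CompleteSpace H] {T : H →L[ℂ] H} {k : ℕ}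
    (hT : sSup (Complex.re '' spectrum ℂ (ContinuousLinearMap.adjoint T ^ k * T ^ k)) < 1) :
    IsUnit (1 - T) := by
  rw [← ContinuousLinearMap.star_eq_adjoint, ← star_pow] at hT
  exact isUnit_one_sub_of_isUnit_one_sub_pow
    (isUnit_one_sub_of_norm_lt_one (norm_lt_one_of_sSup_re_spectrum_star_mul_self_lt_one hT))

theorem exists_norm_geom_sum_le {R : Type*} [NormedRing R] {a : R} (ha : ‖a‖ ≤ 1)
    (h_unit : IsUnit (1 - a)) :
    ∃ C : ℝ, 0 ≤ C ∧ ∀ n, ‖∑ i ∈ Finset.range n, a ^ i‖ ≤ C := by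
  obtain ⟨u, hu⟩ := h_unit
  refine ⟨‖(↑u⁻¹ : R)‖ * (‖(1 : R)‖ + 1), by positivity, fun n => ?_⟩
  rcases n.eq_zero_or_pos with rfl | hn
  · simp only [Finset.range_zero, Finset.sum_empty, norm_zero]
    positivity
  have h_pow : ‖a ^ n‖ ≤ 1 := (norm_pow_le' a hn).trans (pow_le_one₀ (norm_nonneg _) ha)
  calc ‖∑ i ∈ Finset.range n, a ^ i‖ = ‖↑u⁻¹ * (1 - a ^ n)‖ := by
        rw [← mul_neg_geom_sum, ← hu, Units.inv_mul_cancel_left]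
    _ ≤ ‖(↑u⁻¹ : R)‖ * (‖(1 : R)‖ + ‖a ^ n‖) :=
        (norm_mul_le _ _).trans (by gcongr; exact norm_sub_le _ _)
    _ ≤ ‖(↑u⁻¹ : R)‖ * (‖(1 : R)‖ + 1) := by gcongr

end Spectrum

section StationarySequence

variable {𝕜 H H' : Type*} [RCLike 𝕜] [NormedAddCommGroup H] [InnerProductSpace 𝕜 H]
  [NormedAddCommGroup H'] [InnerProductSpace 𝕜 H'] {T : H →L[𝕜] H} {v : ℕ → H'} {f : H}

theorem inner_sum_eq_inner_geom_sum (hv : ∀ i m, ⟪v i, v (i + m)⟫_𝕜 = ⟪f, (T ^ m) f⟫_𝕜) (N : ℕ) :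
    ⟪∑ k ∈ Finset.range N, v k, v N⟫_𝕜 = ⟪f, T ((∑ i ∈ Finset.range N, T ^ i) f)⟫_𝕜 := by
  rw [sum_inner, ← Finset.sum_range_reflect, _root_.sum_apply, map_sum, inner_sum]
  refine Finset.sum_congr rfl fun i hi => ?_
  have h_lag := hv (N - 1 - i) (i + 1)
  have hi_lt := Finset.mem_range.1 hi
  rw [show N - 1 - i + (i + 1) = N by lia, pow_succ'] at h_lag
  exact h_lag

theorem norm_sum_sq_le_of_norm_geom_sum_le (hT : ‖T‖ ≤ 1) {C : ℝ}
    (hC : ∀ n, ‖∑ i ∈ Finset.range n, T ^ i‖ ≤ C)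
    (hv : ∀ i m, ⟪v i, v (i + m)⟫_𝕜 = ⟪f, (T ^ m) f⟫_𝕜) (N : ℕ) :
    ‖∑ k ∈ Finset.range N, v k‖ ^ 2 ≤ (1 + 2 * C) * N * ‖f‖ ^ 2 := by
  induction N with
  | zero => simp
  | succ N ih =>
    have h_diag : ‖v N‖ ^ 2 = ‖f‖ ^ 2 := by
      have h_lag := hv N 0
      rw [add_zero, pow_zero, one_apply_eq_self,
        inner_self_eq_norm_sq_to_K, inner_self_eq_norm_sq_to_K] at h_lag
      exact_mod_cast h_lag
    have h_cross : RCLike.re ⟪∑ k ∈ Finset.range N, v k, v N⟫_𝕜 ≤ C * ‖f‖ ^ 2 := by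
      have h_norm : ‖T ((∑ i ∈ Finset.range N, T ^ i) f)‖ ≤ C * ‖f‖ := by
        refine (T.le_of_opNorm_le hT _).trans ?_
        rw [one_mul]
        exact ContinuousLinearMap.le_of_opNorm_le _ (hC N) f
      rw [inner_sum_eq_inner_geom_sum hv]
      refine (RCLike.re_le_norm _).trans ((norm_inner_le_norm _ _).trans ?_)
      nlinarith [norm_nonneg f]
    rw [Finset.sum_range_succ, norm_add_sq (𝕜 := 𝕜), h_diag]
    push_cast
    linarith

end StationarySequence

/-! ### Stationary sequences whose sums have linearly growing variance -/

section Sampling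

variable {Ω α : Type*} [MeasurableSpace Ω] [MeasurableSpace α] {μ : Measure Ω} {P : Measure α}
  {Z : ℕ → Ω → α}

/-- Each `Z k` has law `P`, and the variance of `f (Z 0) + ⋯ + f (Z (N - 1))` is at most a constant
multiple of `N ∫ f² dP`. This is all that the error bounds use about the dependence structure. -/
structure HasLinearVariance (μ : Measure Ω) (P : Measure α) (Z : ℕ → Ω → α) : Prop where
  measurePreserving : ∀ k, MeasurePreserving (Z k) μ P
  exists_variance_sum_le : ∃ C : ℝ, 0 ≤ C ∧ ∀ f : α → ℝ, Measurable f → MemLp f 2 P → ∀ N : ℕ,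
    Var[fun ω => ∑ k ∈ Finset.range N, f (Z k ω); μ] ≤ C * N * ∫ x, f x ^ 2 ∂P

theorem IsIIDSample.measurePreserving (hZ : IsIIDSample μ P Z) (k : ℕ) :
    MeasurePreserving (Z k) μ P :=
  ⟨hZ.measurable k, hZ.law k⟩

theorem IsIIDSample.hasLinearVariance [IsProbabilityMeasure μ] (hZ : IsIIDSample μ P Z) :
    HasLinearVariance μ P Z := by
  refine ⟨hZ.measurePreserving, 1, zero_le_one, fun f hf hf2 N => ?_⟩
  have h_memLp : ∀ k, MemLp (fun ω => f (Z k ω)) 2 μ := fun k =>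
    hf2.comp_measurePreserving (hZ.measurePreserving k)
  have h_each : ∀ k, Var[fun ω => f (Z k ω); μ] ≤ ∫ x, f x ^ 2 ∂P := fun k => by
    refine (variance_le_expectation_sq (h_memLp k).1).trans_eq ?_
    rw [← hZ.law k, integral_map (hZ.measurable k).aemeasurable
      (hf.pow_const 2).aestronglyMeasurable]
    rfl
  have h_sum : Var[fun ω => ∑ k ∈ Finset.range N, f (Z k ω); μ]
      = ∑ k ∈ Finset.range N, Var[fun ω => f (Z k ω); μ] := by
    rw [← IndepFun.variance_sum (fun k _ => h_memLp k)
      (fun i _ j _ hij => (hZ.indep.indepFun hij).comp hf hf)]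
    congr 1
    ext ω
    simp
  rw [h_sum]
  exact (Finset.sum_le_sum fun k _ => h_each k).trans_eq (by simp)

end Sampling

section SpectralGap

variable {α : Type*} [MeasurableSpace α] {κ : Kernel α α} [IsMarkovKernel κ] {P : Measure α}
  [IsProbabilityMeasure P] {hκ : κ.Invariant P}

theorem isUnit_one_sub_markovOp0_of_spectralGap_pos (h : 0 < spectralGap κ P hκ) :
    IsUnit (1 - markovOp0 κ P hκ) :=
  isUnit_one_sub_of_sSup_re_spectrum_lt_one (A := L20 P →L[ℂ] L20 P) (sub_pos.1 h)

theorem isUnit_one_sub_markovOp0_of_pseudoSpectralGap_pos (h : 0 < pseudoSpectralGap κ P hκ) :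
    IsUnit (1 - markovOp0 κ P hκ) := by
  obtain ⟨k, hk⟩ : ∃ k : ℕ, 0 < opGap (ContinuousLinearMap.adjoint (markovOp0 κ P hκ) ^ (k + 1) *
      markovOp0 κ P hκ ^ (k + 1)) / ((k : ℝ) + 1) := by
    by_contra! h_nonpos
    exact h.not_ge (Real.iSup_nonpos h_nonpos)
  exact isUnit_one_sub_of_sSup_re_spectrum_adjoint_pow_mul_pow_lt_one
    (sub_pos.1 ((div_pos_iff_of_pos_right (by positivity)).1 hk))

theorem norm_markovOp0_le_one : ‖markovOp0 κ P hκ‖ ≤ 1 :=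
  ContinuousLinearMap.opNorm_le_bound _ zero_le_one fun f =>
    (markovOp κ P hκ).le_of_opNorm_le (LinearMap.mkContinuous_norm_le _ zero_le_one _)
      (f : Lp ℂ 2 P)

theorem coe_markovOp0_pow (m : ℕ) (f : L20 P) :
    (((markovOp0 κ P hκ) ^ m) f : Lp ℂ 2 P) = ((markovOp κ P hκ) ^ m) (f : Lp ℂ 2 P) := by
  induction m generalizing f with
  | zero => rfl
  | succ m ih =>
    rw [pow_succ, pow_succ]
    exact ih (markovOp0 κ P hκ f)

end SpectralGap

section Centering

variable {Ω α : Type*} [MeasurableSpace Ω] [MeasurableSpace α] {μ : Measure Ω} {P : Measure α}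
  {Z : ℕ → Ω → α} {f : α → ℝ}

theorem norm_sq_eq_integral_norm_sq (g : Lp ℂ 2 P) : ‖g‖ ^ 2 = ∫ x, ‖g x‖ ^ 2 ∂P := by
  refine Complex.ofReal_injective ?_
  calc ((‖g‖ ^ 2 : ℝ) : ℂ) = ∫ x, ⟪g x, g x⟫_ℂ ∂P := by
        rw [← L2.inner_def, inner_self_eq_norm_sq_to_K]
        norm_cast
    _ = ∫ x, ((‖g x‖ ^ 2 : ℝ) : ℂ) ∂P := by
        simp only [inner_self_eq_norm_sq_to_K, Complex.coe_algebraMap, Complex.ofReal_pow]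
    _ = ((∫ x, ‖g x‖ ^ 2 ∂P : ℝ) : ℂ) := integral_complex_ofReal

theorem integral_sum_comp (hZ : ∀ k, MeasurePreserving (Z k) μ P) (hf : Integrable f P) (N : ℕ) :
    ∫ ω, ∑ k ∈ Finset.range N, f (Z k ω) ∂μ = N * ∫ x, f x ∂P := by
  have h_each : ∀ k, ∫ ω, f (Z k ω) ∂μ = ∫ x, f x ∂P := fun k => by
    rw [← (hZ k).map_eq, integral_map (hZ k).aemeasurable ((hZ k).map_eq ▸ hf.1)]
  have h_int : ∀ k, Integrable (fun ω => f (Z k ω)) μ := fun k =>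
    (hZ k).integrable_comp_of_integrable hf
  rw [integral_finsetSum _ fun k _ => h_int k]
  simp [h_each]

theorem memLp_centered [IsFiniteMeasure P] (hf : MemLp f 2 P) :
    MemLp (fun x => ((f x - ∫ y, f y ∂P : ℝ) : ℂ)) 2 P :=
  (hf.sub (memLp_const _)).ofReal

variable [IsProbabilityMeasure P]

/-- The class of `f - ∫ f dP` in `L²₀(P)`. -/
def centered (hf : MemLp f 2 P) : L20 P :=
  ⟨(memLp_centered hf).toLp _, by
    rw [mem_L20_iff, integral_congr_ae (memLp_centered hf).coeFn_toLp, integral_complex_ofReal,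
      integral_sub (hf.integrable one_le_two) (integrable_const _)]
    simp⟩

theorem coeFn_centered (hf : MemLp f 2 P) :
    (centered hf : Lp ℂ 2 P) =ᵐ[P] fun x => ((f x - ∫ y, f y ∂P : ℝ) : ℂ) :=
  (memLp_centered hf).coeFn_toLp

theorem norm_centered_sq_le (hf : MemLp f 2 P) : ‖centered hf‖ ^ 2 ≤ ∫ x, f x ^ 2 ∂P := by
  calc ‖centered hf‖ ^ 2 = ∫ x, (f x - ∫ y, f y ∂P) ^ 2 ∂P := by
        rw [Submodule.coe_norm, norm_sq_eq_integral_norm_sq]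
        refine integral_congr_ae ?_
        filter_upwards [coeFn_centered hf] with x hx
        rw [hx, Complex.norm_real, Real.norm_eq_abs, sq_abs]
    _ = Var[f; P] := (variance_eq_integral hf.aemeasurable).symm
    _ ≤ ∫ x, f x ^ 2 ∂P := variance_le_expectation_sq hf.1

theorem variance_sum_eq_norm_sum_centered_sq (hZ : ∀ k, MeasurePreserving (Z k) μ P)
    (hf : MemLp f 2 P) (N : ℕ) :
    Var[fun ω => ∑ k ∈ Finset.range N, f (Z k ω); μ] =
      ‖∑ k ∈ Finset.range N,
        Lp.compMeasurePreserving (Z k) (hZ k) (centered hf : Lp ℂ 2 P)‖ ^ 2 := by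
  have h_each : ∀ k, ∀ᵐ ω ∂μ, Lp.compMeasurePreserving (Z k) (hZ k) (centered hf : Lp ℂ 2 P) ω
      = ((f (Z k ω) - ∫ y, f y ∂P : ℝ) : ℂ) := fun k => by
    filter_upwards [Lp.coeFn_compMeasurePreserving (centered hf : Lp ℂ 2 P) (hZ k),
      (hZ k).quasiMeasurePreserving.ae (coeFn_centered hf)] with ω h_comp h_centered
    rw [h_comp, Function.comp_apply, h_centered]
  have h_meas : AEMeasurable (fun ω => ∑ k ∈ Finset.range N, f (Z k ω)) μ :=
    Finset.aemeasurable_fun_sum _ fun k _ =>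
      (hf.aemeasurable.mono_ac (hZ k).map_eq.le.absolutelyContinuous).comp_aemeasurable
        (hZ k).aemeasurable
  rw [norm_sq_eq_integral_norm_sq, variance_eq_integral h_meas,
    integral_sum_comp hZ (hf.integrable one_le_two)]
  refine integral_congr_ae ?_
  filter_upwards [Lp.coeFn_fun_finsetSum (Finset.range N) fun k =>
    Lp.compMeasurePreserving (Z k) (hZ k) (centered hf : Lp ℂ 2 P), ae_all_iff.2 h_each]
    with ω h_sum h_term
  rw [h_sum, Finset.sum_congr rfl fun k _ => h_term k, ← Complex.ofReal_sum, Complex.norm_real,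
    Real.norm_eq_abs, sq_abs, Finset.sum_sub_distrib]
  simp

end Centering

section Chain

variable {Ω α : Type*} [MeasurableSpace Ω] [MeasurableSpace α] {μ : Measure Ω}
  [IsProbabilityMeasure μ] {P : Measure α} {κ : Kernel α α}
  [IsMarkovKernel κ] {Z : ℕ → Ω → α}

namespace IsMarkovChainFrom

theorem map_succ (hZ : IsMarkovChainFrom μ P κ Z) (n : ℕ) :
    μ.map (Z (n + 1)) = (μ.map (Z n)).bind κ := by
  have h_past : Measurable fun ω (i : Fin (n + 1)) => Z i ω :=
    measurable_pi_lambda _ fun i => hZ.measurable i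
  have := Measure.isProbabilityMeasure_map (μ := μ) h_past.aemeasurable
  have h_snd : μ.map (Z (n + 1)) =
      (μ.map fun ω => ((fun i : Fin (n + 1) => Z i ω), Z (n + 1) ω)).snd := by
    rw [Measure.snd, Measure.map_map measurable_snd (h_past.prodMk (hZ.measurable _))]
    rfl
  ext s hs
  rw [h_snd, hZ.markov n, Measure.snd_compProd, Measure.bind_apply hs (Kernel.aemeasurable _),
    Measure.bind_apply hs κ.aemeasurable, lintegral_map (κ.measurable_coe hs) (hZ.measurable n)]
  exact lintegral_map ((κ.measurable_coe hs).comp (measurable_pi_apply (Fin.last n))) h_past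

theorem measurePreserving (hZ : IsMarkovChainFrom μ P κ Z) (hκ : κ.Invariant P) (n : ℕ) :
    MeasurePreserving (Z n) μ P := by
  refine ⟨hZ.measurable n, ?_⟩
  induction n with
  | zero => exact hZ.initial
  | succ n ih => rw [hZ.map_succ, ih, hκ.def]

theorem integral_past_next {E : Type*} [NormedAddCommGroup E] [NormedSpace ℝ E]
    (hZ : IsMarkovChainFrom μ P κ Z) (n : ℕ) {F : (Fin (n + 1) → α) × α → E}
    (hF : StronglyMeasurable F)
    (h_int : Integrable (fun ω => F (fun i => Z i ω, Z (n + 1) ω)) μ) :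
    ∫ ω, F (fun i => Z i ω, Z (n + 1) ω) ∂μ =
      ∫ ω, ∫ y, F (fun i => Z i ω, y) ∂(κ (Z n ω)) ∂μ := by
  have h_past : Measurable fun ω (i : Fin (n + 1)) => Z i ω :=
    measurable_pi_lambda _ fun i => hZ.measurable i
  have h_joint := h_past.prodMk (hZ.measurable (n + 1))
  have := Measure.isProbabilityMeasure_map (μ := μ) h_past.aemeasurable
  have h_int_map := (integrable_map_measure hF.aestronglyMeasurable h_joint.aemeasurable).2 h_int
  rw [← integral_map h_joint.aemeasurable hF.aestronglyMeasurable]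
  rw [hZ.markov n] at h_int_map ⊢
  rw [Measure.integral_compProd h_int_map,
    integral_map h_past.aemeasurable hF.integral_kernel_prod_right'.aestronglyMeasurable]
  rfl

variable [IsProbabilityMeasure P]

theorem inner_comp_succ (hZ : IsMarkovChainFrom μ P κ Z) (hκ : κ.Invariant P)
    {i n : ℕ} (hi : i ≤ n) (f g : Lp ℂ 2 P) :
    ⟪Lp.compMeasurePreserving (Z i) (hZ.measurePreserving hκ i) f,
      Lp.compMeasurePreserving (Z (n + 1)) (hZ.measurePreserving hκ (n + 1)) g⟫_ℂ =
    ⟪Lp.compMeasurePreserving (Z i) (hZ.measurePreserving hκ i) f,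
      Lp.compMeasurePreserving (Z n) (hZ.measurePreserving hκ n) (markovOp κ P hκ g)⟫_ℂ := by
  let F : (Fin (n + 1) → α) × α → ℂ := fun z => ⟪f (z.1 ⟨i, by lia⟩), g z.2⟫_ℂ
  have hF : StronglyMeasurable F :=
    ((Lp.stronglyMeasurable f).comp_measurable
      ((measurable_pi_apply _).comp measurable_fst)).inner
      ((Lp.stronglyMeasurable g).comp_measurable measurable_snd)
  have h_coe := fun (k : ℕ) (g : Lp ℂ 2 P) =>
    Lp.coeFn_compMeasurePreserving g (hZ.measurePreserving hκ k)
  have h_inner : (fun ω => ⟪Lp.compMeasurePreserving (Z i) (hZ.measurePreserving hκ i) f ω,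
      Lp.compMeasurePreserving (Z (n + 1)) (hZ.measurePreserving hκ (n + 1)) g ω⟫_ℂ) =ᵐ[μ]
      fun ω => F (fun i => Z i ω, Z (n + 1) ω) := by
    filter_upwards [h_coe i f, h_coe (n + 1) g] with ω hf hg
    rw [hf, hg]
    rfl
  rw [L2.inner_def, L2.inner_def, integral_congr_ae h_inner,
    hZ.integral_past_next n hF ((L2.integrable_inner (𝕜 := ℂ) _ _).congr h_inner)]
  refine integral_congr_ae ?_
  filter_upwards [h_coe i f, h_coe n (markovOp κ P hκ g),
    (hZ.measurePreserving hκ n).quasiMeasurePreserving.ae (markovOp_coeFn κ P hκ g),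
    (hZ.measurePreserving hκ n).quasiMeasurePreserving.ae (integrable_ae_of_invariant hκ g)]
    with ω hf hTg h_op h_int
  rw [hf, hTg, Function.comp_apply, Function.comp_apply, h_op, ← integral_inner h_int]

theorem inner_comp_add (hZ : IsMarkovChainFrom μ P κ Z) (hκ : κ.Invariant P)
    (i m : ℕ) (f g : Lp ℂ 2 P) :
    ⟪Lp.compMeasurePreserving (Z i) (hZ.measurePreserving hκ i) f,
      Lp.compMeasurePreserving (Z (i + m)) (hZ.measurePreserving hκ (i + m)) g⟫_ℂ =
    ⟪f, ((markovOp κ P hκ) ^ m) g⟫_ℂ := by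
  induction m generalizing g with
  | zero => exact (Lp.compMeasurePreservingₗᵢ ℂ (Z i) (hZ.measurePreserving hκ i)).inner_map_map f g
  | succ m ih =>
    rw [pow_succ]
    exact (hZ.inner_comp_succ hκ (Nat.le_add_right i m) f g).trans (ih _)

theorem hasLinearVariance (hZ : IsMarkovChainFrom μ P κ Z) {hκ : κ.Invariant P}
    (h_unit : IsUnit (1 - markovOp0 κ P hκ)) : HasLinearVariance μ P Z := by
  obtain ⟨C, hC0, hC⟩ := exists_norm_geom_sum_le (R := L20 P →L[ℂ] L20 P)
    norm_markovOp0_le_one h_unit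
  refine ⟨hZ.measurePreserving hκ, 1 + 2 * C, by positivity, fun f _ hf N => ?_⟩
  have h_norm_sum := norm_sum_sq_le_of_norm_geom_sum_le norm_markovOp0_le_one hC (fun i m =>
    (hZ.inner_comp_add hκ i m (centered hf) (centered hf)).trans (by
      rw [← coe_markovOp0_pow, ← Submodule.coe_inner])) N
  rw [variance_sum_eq_norm_sum_centered_sq (hZ.measurePreserving hκ) hf]
  exact h_norm_sum.trans (by gcongr; exact norm_centered_sq_le hf)

end IsMarkovChainFrom

theorem IsIIDOrStationaryWithGap.hasLinearVariance [IsProbabilityMeasure P]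
    (hZ : IsIIDOrStationaryWithGap μ P Z) : HasLinearVariance μ P Z := by
  rcases hZ with hZ | ⟨κ, _, hκ, hZ, h_gap | h_gap⟩
  · exact hZ.hasLinearVariance
  · exact hZ.hasLinearVariance (isUnit_one_sub_markovOp0_of_spectralGap_pos h_gap)
  · exact hZ.hasLinearVariance (isUnit_one_sub_markovOp0_of_pseudoSpectralGap_pos h_gap)

end Chain

/-! ### Balancing the bandwidth -/

section Rates

open Asymptotics

theorem IsBigOSeq.trans_isBigO {a : ℕ → ℝ≥0∞} {b c : ℕ → ℝ} (hab : IsBigOSeq a b)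
    (hbc : b =O[atTop] c) (hc : ∀ N, 0 ≤ c N) : IsBigOSeq a c := by
  obtain ⟨C, hC⟩ := hab
  obtain ⟨D, hD⟩ := hbc.bound
  refine ⟨|C| * D, ?_⟩
  filter_upwards [hC, hD] with N ha hb
  rw [Real.norm_of_nonneg (hc N)] at hb
  refine ha.trans (ENNReal.ofReal_le_ofReal ?_)
  calc C * b N ≤ |C| * ‖b N‖ := (le_abs_self _).trans_eq (abs_mul _ _)
    _ ≤ |C| * (D * c N) := by gcongr
    _ = |C| * D * c N := (mul_assoc _ _ _).symm

theorem isBigO_iff_eventually_div_le {ι : Type*} {l : Filter ι} {a r : ι → ℝ}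
    (ha : ∀ᶠ i in l, 0 ≤ a i) (hr : ∀ᶠ i in l, 0 < r i) :
    a =O[l] r ↔ ∃ C, ∀ᶠ i in l, a i / r i ≤ C := by
  rw [isBigO_iff]
  refine exists_congr fun C => eventually_congr ?_
  filter_upwards [ha, hr] with i ha hr
  rw [Real.norm_of_nonneg ha, Real.norm_of_nonneg hr.le, div_le_iff₀ hr]

/-- The order of the bandwidth for which the two terms of `absBound`, and those of `sqBound`,
are of the same order. -/
def balancedBandwidth (d N : ℕ) : ℝ := (N : ℝ) ^ (-(1 : ℝ) / (d + 4))

theorem balancedBandwidth_pos (d : ℕ) {N : ℕ} (hN : 0 < N) : 0 < balancedBandwidth d N :=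
  Real.rpow_pos_of_pos (by exact_mod_cast hN) _

theorem balancedBandwidth_pow (d N k : ℕ) :
    balancedBandwidth d N ^ k = (N : ℝ) ^ (-(k : ℝ) / (d + 4)) := by
  rw [balancedBandwidth, ← Real.rpow_natCast, ← Real.rpow_mul (Nat.cast_nonneg N)]
  congr 1
  ring

theorem natCast_mul_balancedBandwidth_pow (d : ℕ) {N : ℕ} (hN : 0 < N) :
    (N : ℝ) * balancedBandwidth d N ^ d = 1 / balancedBandwidth d N ^ 4 := by
  have hN' : (0 : ℝ) < N := by exact_mod_cast hN
  have hr := balancedBandwidth_pos d hN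
  have h_exp : -((d + 4 : ℕ) : ℝ) / (d + 4) = -1 := by
    push_cast
    field_simp
  rw [eq_div_iff (by positivity), mul_assoc, ← pow_add, balancedBandwidth_pow, h_exp,
    Real.rpow_neg_one, mul_inv_cancel₀ hN'.ne']

/-- The value of `absBound` at the bandwidth `s * balancedBandwidth d N`, divided by its order
`balancedBandwidth d N ^ 2`. -/
def rescaledBound (d : ℕ) (s : ℝ) : ℝ := 1 / √(s ^ d) + s ^ 2

theorem absBound_div_balancedBandwidth_sq (d : ℕ) (b : ℕ → ℝ) {N : ℕ} (hN : 0 < N) :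
    absBound d b N / balancedBandwidth d N ^ 2 =
      rescaledBound d (b N / balancedBandwidth d N) := by
  set r := balancedBandwidth d N
  have hr : 0 < r := balancedBandwidth_pos d hN
  set s := b N / r
  have hb : b N = s * r := (div_mul_cancel₀ _ hr.ne').symm
  have h_size : (N : ℝ) * (s * r) ^ d = s ^ d / (r ^ 2) ^ 2 := by
    rw [mul_pow, mul_left_comm, natCast_mul_balancedBandwidth_pow d hN]
    ring
  rw [absBound, hb, h_size, Real.sqrt_div' _ (by positivity), Real.sqrt_sq (by positivity),
    rescaledBound]
  field_simp

theorem one_le_rescaledBound (d : ℕ) {s : ℝ} (hs : 0 < s) : 1 ≤ rescaledBound d s := by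
  rcases le_total s 1 with h | h
  · refine le_add_of_le_of_nonneg ?_ (sq_nonneg s)
    rw [one_le_div (by positivity)]
    exact Real.sqrt_le_one.2 (pow_le_one₀ hs.le h)
  · exact le_add_of_nonneg_of_le (by positivity) (one_le_pow₀ h)

theorem le_sqrt_of_rescaledBound_le {d : ℕ} {s C : ℝ} (h : rescaledBound d s ≤ C) : s ≤ √C :=
  Real.le_sqrt_of_sq_le ((le_add_of_nonneg_left (by positivity)).trans h)

theorem inv_le_of_rescaledBound_le {d : ℕ} (hd : 0 < d) {s C : ℝ} (hs : 0 < s)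
    (h : rescaledBound d s ≤ C) : s⁻¹ ≤ max 1 (C ^ 2) := by
  rcases le_total s 1 with hs1 | hs1
  · refine le_max_of_le_right ?_
    have h_inv_pow : (s ^ d)⁻¹ ≤ C ^ 2 := by
      have h_inv_sqrt : 1 / √(s ^ d) ≤ C := (le_add_of_nonneg_right (sq_nonneg s)).trans h
      calc (s ^ d)⁻¹ = (1 / √(s ^ d)) ^ 2 := by
            rw [one_div, inv_pow, Real.sq_sqrt (by positivity)]
        _ ≤ C ^ 2 := by gcongr
    exact (inv_anti₀ (by positivity) (pow_le_of_le_one hs.le hs1 hd.ne')).trans h_inv_pow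
  · exact le_max_of_le_left (inv_le_one_of_one_le₀ hs1)

theorem rescaledBound_le {d : ℕ} {s A B : ℝ} (hs : 0 < s) (hA : s ≤ A) (hB : s⁻¹ ≤ B) :
    rescaledBound d s ≤ √(B ^ d) + A ^ 2 := by
  rw [rescaledBound, one_div, ← Real.sqrt_inv, ← inv_pow]
  gcongr

theorem absBound_nonneg (d : ℕ) (b : ℕ → ℝ) (N : ℕ) : 0 ≤ absBound d b N := by
  unfold absBound
  positivity

theorem sqBound_nonneg (d : ℕ) {b : ℕ → ℝ} (hb : ∀ N, 0 < b N) (N : ℕ) : 0 ≤ sqBound d b N := by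
  have := hb N
  unfold sqBound
  positivity

variable {d : ℕ} {b : ℕ → ℝ} (hb : ∀ N, 0 < b N)

include hb

theorem balancedBandwidth_sq_isBigO_absBound :
    (fun N => balancedBandwidth d N ^ 2) =O[atTop] absBound d b := by
  refine IsBigO.of_bound 1 ?_
  filter_upwards [eventually_gt_atTop 0] with N hN
  have hr := balancedBandwidth_pos d hN
  have h := one_le_rescaledBound d (div_pos (hb N) hr)
  rw [← absBound_div_balancedBandwidth_sq d b hN, one_le_div (by positivity)] at h
  rwa [one_mul, Real.norm_of_nonneg (by positivity), Real.norm_of_nonneg (absBound_nonneg d b N)]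

theorem absBound_isBigO_balancedBandwidth_sq_iff (hd : 0 < d) :
    (absBound d b =O[atTop] fun N => balancedBandwidth d N ^ 2) ↔
      b =Θ[atTop] balancedBandwidth d := by
  have hr : ∀ᶠ N in atTop, 0 < balancedBandwidth d N :=
    (eventually_gt_atTop 0).mono fun _ => balancedBandwidth_pos d
  have hb' : ∀ᶠ N in atTop, 0 < b N := .of_forall hb
  rw [IsTheta, isBigO_iff_eventually_div_le (.of_forall (absBound_nonneg d b))
      (hr.mono fun _ h => pow_pos h 2),
    isBigO_iff_eventually_div_le (hb'.mono fun _ => le_of_lt) hr,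
    isBigO_iff_eventually_div_le (hr.mono fun _ => le_of_lt) hb']
  constructor
  · rintro ⟨C, hC⟩
    refine ⟨⟨√C, ?_⟩, max 1 (C ^ 2), ?_⟩
    all_goals
      filter_upwards [hC, eventually_gt_atTop 0] with N h hN
      rw [absBound_div_balancedBandwidth_sq d b hN] at h
    · exact le_sqrt_of_rescaledBound_le h
    · rw [← inv_div]
      exact inv_le_of_rescaledBound_le hd (div_pos (hb N) (balancedBandwidth_pos d hN)) h
  · rintro ⟨⟨A, hA⟩, B, hB⟩
    refine ⟨√(B ^ d) + A ^ 2, ?_⟩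
    filter_upwards [hA, hB, eventually_gt_atTop 0] with N h_le h_inv_le hN
    rw [absBound_div_balancedBandwidth_sq d b hN]
    exact rescaledBound_le (div_pos (hb N) (balancedBandwidth_pos d hN)) h_le
      ((inv_div _ _).trans_le h_inv_le)

theorem sqBound_isTheta_absBound_sq : sqBound d b =Θ[atTop] fun N => absBound d b N ^ 2 := by
  have h_size : ∀ N : ℕ, 1 / ((N : ℝ) * b N ^ d) = (1 / √((N : ℝ) * b N ^ d)) ^ 2 := fun N => by
    rw [div_pow, one_pow,
      Real.sq_sqrt (mul_nonneg (Nat.cast_nonneg N) (pow_nonneg (hb N).le _))]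
  constructor
  · refine IsBigO.of_bound 1 (.of_forall fun N => ?_)
    rw [Real.norm_of_nonneg (sqBound_nonneg d hb N), Real.norm_of_nonneg (sq_nonneg _), one_mul,
      sqBound, absBound, h_size]
    nlinarith [show 0 ≤ 1 / √((N : ℝ) * b N ^ d) * b N ^ 2 by positivity]
  · refine IsBigO.of_bound 2 (.of_forall fun N => ?_)
    rw [Real.norm_of_nonneg (sqBound_nonneg d hb N), Real.norm_of_nonneg (sq_nonneg _),
      sqBound, absBound, h_size]
    nlinarith [sq_nonneg (1 / √((N : ℝ) * b N ^ d) - b N ^ 2)]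

theorem balancedBandwidth_pow_four_isBigO_sqBound :
    (fun N => balancedBandwidth d N ^ 4) =O[atTop] sqBound d b := by
  refine (((balancedBandwidth_sq_isBigO_absBound hb).pow 2).trans
    (sqBound_isTheta_absBound_sq hb).2).congr_left fun N => ?_
  rw [← pow_mul]

theorem sqBound_isBigO_balancedBandwidth_pow_four_iff (hd : 0 < d) :
    (sqBound d b =O[atTop] fun N => balancedBandwidth d N ^ 4) ↔
      b =Θ[atTop] balancedBandwidth d := by
  have h_pow : (fun N => balancedBandwidth d N ^ 4) =
      fun N => (balancedBandwidth d N ^ 2) ^ 2 := by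
    funext N
    rw [← pow_mul]
  rw [h_pow, (sqBound_isTheta_absBound_sq hb).isBigO_congr_left,
    ← absBound_isBigO_balancedBandwidth_sq_iff hb hd]
  exact ⟨fun h => h.of_pow two_ne_zero, fun h => h.pow 2⟩

end Rates

/-! ### Weak directional derivatives -/

section WeakDerivative

variable {E : Type*} [NormedAddCommGroup E] [NormedSpace ℝ E]

/-- Test functions: the smooth real functions of compact support. -/
structure IsTestFunction (φ : E → ℝ) : Prop where
  contDiff : ContDiff ℝ ((⊤ : ℕ∞) : WithTop ℕ∞) φ
  hasCompactSupport : HasCompactSupport φ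

namespace IsTestFunction

variable {φ : E → ℝ}

theorem continuous (hφ : IsTestFunction φ) : Continuous φ := hφ.contDiff.continuous

theorem differentiable (hφ : IsTestFunction φ) : Differentiable ℝ φ :=
  hφ.contDiff.differentiable (by simp)

theorem fderiv_apply (hφ : IsTestFunction φ) (v : E) :
    IsTestFunction fun x => fderiv ℝ φ x v where
  contDiff := (hφ.contDiff.fderiv_right (by simp)).clm_apply contDiff_const
  hasCompactSupport := hφ.hasCompactSupport.fderiv_apply ℝ v

theorem comp_sub_right (hφ : IsTestFunction φ) (v : E) : IsTestFunction fun x => φ (x - v) where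
  contDiff := hφ.contDiff.comp (contDiff_id.sub contDiff_const)
  hasCompactSupport := hφ.hasCompactSupport.comp_homeomorph (Homeomorph.subRight v)

theorem exists_bound (hφ : IsTestFunction φ) : ∃ C, ∀ x, ‖φ x‖ ≤ C :=
  hφ.hasCompactSupport.exists_bound_of_continuous hφ.continuous

theorem sub_comp_sub_smul_eq_integral (hφ : IsTestFunction φ) (x v : E) (t : ℝ) :
    φ x - φ (x - t • v) = ∫ s in 0..t, fderiv ℝ φ (x - s • v) v := by
  have hderiv (s : ℝ) :
      HasDerivAt (fun s : ℝ => -φ (x - s • v)) (fderiv ℝ φ (x - s • v) v) s := by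
    have hline : HasDerivAt (fun s : ℝ => x - s • v) (-v) s := by
      simpa using ((hasDerivAt_id s).smul_const v).const_sub x
    exact ((hφ.differentiable _).hasFDerivAt.comp_hasDerivAt s hline).neg.congr_deriv (by simp)
  have hcont : Continuous fun s : ℝ => fderiv ℝ φ (x - s • v) v :=
    (hφ.fderiv_apply v).continuous.comp (by fun_prop)
  rw [intervalIntegral.integral_eq_sub_of_hasDerivAt (fun s _ => hderiv s)
    (hcont.intervalIntegrable _ _), zero_smul, sub_zero]
  ring

variable [MeasurableSpace E] [BorelSpace E] {ν : Measure E}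

theorem integrable_mul (hφ : IsTestFunction φ) {f : E → ℝ} (hf : LocallyIntegrable f ν) :
    Integrable (fun x => f x * φ x) ν :=
  hf.integrable_smul_right_of_hasCompactSupport hφ.continuous hφ.hasCompactSupport

end IsTestFunction

variable [MeasurableSpace E] [BorelSpace E] {ν : Measure E} {v : E} {f g : E → ℝ}

/-- `g` is the weak derivative of `f` in the direction `v` with respect to the measure `ν`. -/
def HasWeakDeriv (ν : Measure E) (v : E) (f g : E → ℝ) : Prop :=
  ∀ φ : E → ℝ, IsTestFunction φ → ∫ x, f x * fderiv ℝ φ x v ∂ν = -∫ x, g x * φ x ∂ν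

theorem HasWeakDeriv.sum_smul {ι : Type*} [Fintype ι] {e : ι → E} {g : ι → E → ℝ}
    (hf : LocallyIntegrable f ν) (hg : ∀ i, LocallyIntegrable (g i) ν)
    (hfg : ∀ i, HasWeakDeriv ν (e i) f (g i)) (c : ι → ℝ) :
    HasWeakDeriv ν (∑ i, c i • e i) f (fun x => ∑ i, c i * g i x) := by
  intro φ hφ
  have hleft (x : E) : f x * fderiv ℝ φ x (∑ i, c i • e i) =
      ∑ i, c i * (f x * fderiv ℝ φ x (e i)) := by
    simp only [map_sum, map_smul, smul_eq_mul, Finset.mul_sum, mul_left_comm (f x)]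
  have hright (x : E) : (∑ i, c i * g i x) * φ x = ∑ i, c i * (g i x * φ x) := by
    simp only [Finset.sum_mul, mul_assoc]
  simp only [hleft, hright]
  rw [integral_finsetSum _ fun i _ => ((hφ.fderiv_apply (e i)).integrable_mul hf).const_mul _,
    integral_finsetSum _ fun i _ => (hφ.integrable_mul (hg i)).const_mul _,
    ← Finset.sum_neg_distrib]
  simp only [integral_const_mul, hfg _ φ hφ, mul_neg]

theorem HasWeakDeriv.sum_left {ι : Type*} [Fintype ι] {f g : ι → E → ℝ}
    (hf : ∀ i, LocallyIntegrable (f i) ν) (hg : ∀ i, LocallyIntegrable (g i) ν)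
    (hfg : ∀ i, HasWeakDeriv ν v (f i) (g i)) (c : ι → ℝ) :
    HasWeakDeriv ν v (fun x => ∑ i, c i * f i x) (fun x => ∑ i, c i * g i x) := by
  intro φ hφ
  simp only [Finset.sum_mul, mul_assoc]
  rw [integral_finsetSum _ fun i _ => ((hφ.fderiv_apply v).integrable_mul (hf i)).const_mul _,
    integral_finsetSum _ fun i _ => (hφ.integrable_mul (hg i)).const_mul _,
    ← Finset.sum_neg_distrib]
  simp only [integral_const_mul, hfg _ φ hφ, mul_neg]

theorem HasWeakDeriv.integral_mul_fderiv_comp_sub [ν.IsAddRightInvariant]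
    (hfg : HasWeakDeriv ν v f g) {φ : E → ℝ} (hφ : IsTestFunction φ)
    (w : E) :
    ∫ x, f x * fderiv ℝ φ (x - w) v ∂ν = -∫ x, g (x + w) * φ x ∂ν := by
  have h := hfg _ (hφ.comp_sub_right w)
  rw [← integral_add_right_eq_self (fun x => g x * φ (x - w)) w] at h
  simpa only [fderiv_comp_sub, add_sub_cancel_right] using h

variable [FiniteDimensional ℝ E]

theorem ae_eq_of_integral_mul_testFunction_eq (hf : LocallyIntegrable f ν)
    (hg : LocallyIntegrable g ν)
    (h : ∀ φ, IsTestFunction φ → ∫ x, f x * φ x ∂ν = ∫ x, g x * φ x ∂ν) : f =ᵐ[ν] g :=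
  ae_eq_of_integral_contDiff_smul_eq hf hg fun φ hφ hφc => by
    simpa only [smul_eq_mul, mul_comm] using h φ ⟨hφ, hφc⟩

variable [ν.IsAddHaarMeasure]

theorem integrable_mul_comp_add {Y : Type*} [MeasurableSpace Y] {τ : Measure Y} [SFinite τ]
    {k : Y → ℝ} (hk : Integrable k τ) (hf : Integrable f ν) {a : Y → E} (ha : Measurable a) :
    Integrable (fun z : E × Y => k z.2 * f (z.1 + a z.2)) (ν.prod τ) := by
  have hshear : Measure.QuasiMeasurePreserving (fun z : E × Y => z.1 + a z.2) (ν.prod τ) ν :=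
    QuasiMeasurePreserving.prod_of_left (by fun_prop) <| ae_of_all _ fun y =>
      (measurePreserving_add_right ν (a y)).quasiMeasurePreserving
  have hmeas : AEStronglyMeasurable (fun z : E × Y => k z.2 * f (z.1 + a z.2)) (ν.prod τ) :=
    hk.1.comp_snd.mul (hf.1.comp_quasiMeasurePreserving hshear)
  rw [integrable_prod_iff' hmeas]
  refine ⟨ae_of_all _ fun y => (hf.comp_add_right (a y)).const_mul (k y), ?_⟩
  simp only [norm_mul, integral_const_mul,
    fun y : Y => integral_add_right_eq_self (μ := ν) (fun x => ‖f x‖) (a y)]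
  exact hk.norm.mul_const _

theorem integrable_comp_add_smul (hf : Integrable f ν) (v : E) (τ : Measure ℝ)
    [IsFiniteMeasure τ] : Integrable (fun z : E × ℝ => f (z.1 + z.2 • v)) (ν.prod τ) := by
  simpa using integrable_mul_comp_add (integrable_const (1 : ℝ)) hf
    (by fun_prop : Measurable fun t : ℝ => t • v)

theorem HasWeakDeriv.integral_mul_sub_comp_sub_smul (hfg : HasWeakDeriv ν v f g)
    (hf : Integrable f ν) {t : ℝ} (ht : 0 ≤ t) {φ : E → ℝ} (hφ : IsTestFunction φ) :
    ∫ x, f x * (φ x - φ (x - t • v)) ∂ν = -∫ s in 0..t, ∫ x, g (x + s • v) * φ x ∂ν := by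
  simp only [hφ.sub_comp_sub_smul_eq_integral, intervalIntegral.integral_of_le ht,
    ← integral_const_mul]
  set τ : Measure ℝ := volume.restrict (Set.Ioc 0 t)
  obtain ⟨C, hC⟩ := (hφ.fderiv_apply v).exists_bound
  have hint : Integrable (fun z : E × ℝ => f z.1 * fderiv ℝ φ (z.1 - z.2 • v) v) (ν.prod τ) :=
    (hf.comp_fst τ).mul_bdd ((hφ.fderiv_apply v).continuous.comp
      (by fun_prop : Continuous fun z : E × ℝ => z.1 - z.2 • v)).aestronglyMeasurable
      (ae_of_all _ fun z => hC _)
  rw [integral_integral_swap hint]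
  simp only [hfg.integral_mul_fderiv_comp_sub hφ, integral_neg]

theorem integral_integral_comp_add_smul_mul_testFunction (hg : Integrable g ν) (v : E) {t : ℝ}
    (ht : 0 ≤ t) {φ : E → ℝ} (hφ : IsTestFunction φ) :
    ∫ x, (∫ s in 0..t, g (x + s • v)) * φ x ∂ν = ∫ s in 0..t, ∫ x, g (x + s • v) * φ x ∂ν := by
  simp only [intervalIntegral.integral_of_le ht, ← integral_mul_const]
  obtain ⟨C, hC⟩ := hφ.exists_bound
  exact integral_integral_swap <| (integrable_comp_add_smul hg v _).mul_bdd
    (hφ.continuous.comp continuous_fst).aestronglyMeasurable (ae_of_all _ fun z => hC _)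

theorem HasWeakDeriv.integral_sub_mul_testFunction (hfg : HasWeakDeriv ν v f g)
    (hf : Integrable f ν) (hg : Integrable g ν) {t : ℝ} (ht : 0 ≤ t) {φ : E → ℝ}
    (hφ : IsTestFunction φ) :
    ∫ x, (f (x + t • v) - f x) * φ x ∂ν = ∫ x, (∫ s in 0..t, g (x + s • v)) * φ x ∂ν := by
  have hfφ : Integrable (fun x => f x * φ x) ν := hφ.integrable_mul hf.locallyIntegrable
  have hshift : ∫ x, f (x + t • v) * φ x ∂ν = ∫ x, f x * φ (x - t • v) ∂ν := by
    simpa using integral_add_right_eq_self (μ := ν) (fun x => f x * φ (x - t • v)) (t • v)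
  calc ∫ x, (f (x + t • v) - f x) * φ x ∂ν
      = ∫ x, f x * φ (x - t • v) ∂ν - ∫ x, f x * φ x ∂ν := by
        simp only [sub_mul]
        rw [integral_sub (hφ.integrable_mul (hf.comp_add_right _).locallyIntegrable) hfφ, hshift]
    _ = -∫ x, f x * (φ x - φ (x - t • v)) ∂ν := by
        simp only [mul_sub]
        rw [integral_sub hfφ ((hφ.comp_sub_right _).integrable_mul hf.locallyIntegrable), neg_sub]
    _ = ∫ x, (∫ s in 0..t, g (x + s • v)) * φ x ∂ν := by
        rw [hfg.integral_mul_sub_comp_sub_smul hf ht hφ, neg_neg,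
          integral_integral_comp_add_smul_mul_testFunction hg v ht hφ]

theorem HasWeakDeriv.ae_sub_eq_integral (hfg : HasWeakDeriv ν v f g) (hf : Integrable f ν)
    (hg : Integrable g ν) {t : ℝ} (ht : 0 ≤ t) :
    ∀ᵐ x ∂ν, f (x + t • v) - f x = ∫ s in 0..t, g (x + s • v) := by
  refine ae_eq_of_integral_mul_testFunction_eq
    ((hf.comp_add_right _).sub hf).locallyIntegrable ?_ fun φ hφ =>
      hfg.integral_sub_mul_testFunction hf hg ht hφ
  simp only [intervalIntegral.integral_of_le ht]
  exact (integrable_comp_add_smul hg v _).integral_prod_left.locallyIntegrable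

theorem HasWeakDeriv.ae_enorm_sub_le (hfg : HasWeakDeriv ν v f g) (hf : Integrable f ν)
    (hg : Integrable g ν) {t : ℝ} (ht : 0 ≤ t) :
    ∀ᵐ x ∂ν, ‖f (x + t • v) - f x‖ₑ ≤ ∫⁻ s in Set.Ioc 0 t, ‖g (x + s • v)‖ₑ := by
  filter_upwards [hfg.ae_sub_eq_integral hf hg ht] with x hx
  rw [hx, intervalIntegral.integral_of_le ht]
  exact enorm_integral_le_lintegral_enorm _

theorem HasWeakDeriv.ae_enorm_sub_sub_le {w : E → ℝ} (hfg : HasWeakDeriv ν v f g)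
    (hgw : HasWeakDeriv ν v g w) (hf : Integrable f ν) (hg : Integrable g ν)
    (hw : Integrable w ν) (hgm : Measurable g) (hwm : Measurable w) :
    ∀ᵐ x ∂ν, ‖f (x + v) - f x - g x‖ₑ ≤ ∫⁻ s in Set.Ioc (0 : ℝ) 1, ‖w (x + s • v)‖ₑ := by
  set τ : Measure ℝ := volume.restrict (Set.Ioc 0 1)
  have hτ : τ Set.univ = 1 := by simp [τ]
  have hremainder : ∀ᵐ x ∂ν, ∀ᵐ t ∂τ,
      ‖g (x + t • v) - g x‖ₑ ≤ ∫⁻ s, ‖w (x + s • v)‖ₑ ∂τ := by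
    refine (Measure.ae_ae_comm (μ := ν) (ν := τ) (measurableSet_le ?_ ?_)).2 ?_
    · fun_prop
    · exact (Measurable.lintegral_prod_right' (f := fun z : E × ℝ => ‖w (z.1 + z.2 • v)‖ₑ)
        (by fun_prop)).comp measurable_fst
    · filter_upwards [ae_restrict_mem measurableSet_Ioc] with t ht
      filter_upwards [hgw.ae_enorm_sub_le hg hw ht.1.le] with x hx
      exact hx.trans (lintegral_mono_set (Set.Ioc_subset_Ioc_right ht.2))
  filter_upwards [hremainder, hfg.ae_sub_eq_integral hf hg zero_le_one,
    (integrable_comp_add_smul hg v τ).prod_right_ae] with x hx hfx hgx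
  have hrepr : f (x + v) - f x - g x = ∫ t, (g (x + t • v) - g x) ∂τ := by
    rw [one_smul, intervalIntegral.integral_of_le zero_le_one] at hfx
    rw [integral_sub hgx (integrable_const _), ← hfx, integral_const, measureReal_def, hτ]
    simp
  calc ‖f (x + v) - f x - g x‖ₑ
      ≤ ∫⁻ t, ‖g (x + t • v) - g x‖ₑ ∂τ := hrepr ▸ enorm_integral_le_lintegral_enorm _
    _ ≤ ∫⁻ _, (∫⁻ s, ‖w (x + s • v)‖ₑ ∂τ) ∂τ := lintegral_mono_ae hx
    _ = ∫⁻ s, ‖w (x + s • v)‖ₑ ∂τ := by rw [lintegral_const, hτ, mul_one]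

end WeakDerivative

section Sobolev

variable {d : ℕ} {p : EuclideanSpace ℝ (Fin d) → ℝ} {q : ℝ≥0∞}

theorem MemSobolev.exists_measurable_partialDeriv {k : ℕ} (h1 : MemSobolev k 1 p)
    (hpq : MemSobolev k q p) (hq : 1 ≤ q) {n : ℕ} (hn : n ≤ k) (a : Fin n → Fin d) :
    ∃ g : EuclideanSpace ℝ (Fin d) → ℝ, Measurable g ∧ Integrable g ∧ MemLp g q ∧
      ∀ φ, IsTestFunction φ →
        ∫ x, p x * iteratedFDeriv ℝ n φ x (fun j => EuclideanSpace.single (a j) (1 : ℝ)) =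
          (-1) ^ n * ∫ x, g x * φ x := by
  obtain ⟨g, hg, hgφ⟩ := h1.2 n hn a
  obtain ⟨g', hg', hgφ'⟩ := hpq.2 n hn a
  have hgI : Integrable g := memLp_one_iff_integrable.1 hg
  have hgg' : g =ᵐ[volume] g' :=
    ae_eq_of_integral_mul_testFunction_eq hgI.locallyIntegrable (hg'.locallyIntegrable hq)
      fun φ ⟨hφ, hφc⟩ => mul_left_cancel₀ (pow_ne_zero n (by norm_num))
        ((hgφ φ hφ hφc).symm.trans (hgφ' φ hφ hφc))
  have hmk := hgI.1.ae_eq_mk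
  refine ⟨hgI.1.mk g, hgI.1.measurable_mk, hgI.congr hmk, (hg'.ae_eq hgg'.symm).ae_eq hmk,
    fun φ ⟨hφ, hφc⟩ => (hgφ φ hφ hφc).trans ?_⟩
  exact congrArg _ (integral_congr_ae (hmk.mul (.refl _ φ)))

theorem MemSobolev.exists_gradient_hessian (h1 : MemSobolev 2 1 p) (hpq : MemSobolev 2 q p)
    (hq : 1 ≤ q) :
    ∃ (g : Fin d → EuclideanSpace ℝ (Fin d) → ℝ)
      (H : Fin d → Fin d → EuclideanSpace ℝ (Fin d) → ℝ),
      (∀ i, Measurable (g i) ∧ Integrable (g i) ∧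
        HasWeakDeriv volume (EuclideanSpace.single i 1) p (g i)) ∧
      ∀ i j, Measurable (H i j) ∧ Integrable (H i j) ∧ MemLp (H i j) q ∧
        HasWeakDeriv volume (EuclideanSpace.single j 1) (g i) (H i j) := by
  choose g hgm hgI _ hg using fun i : Fin d =>
    h1.exists_measurable_partialDeriv hpq hq one_le_two (fun _ => i)
  choose H hHm hHI hHq hH using fun i j : Fin d =>
    h1.exists_measurable_partialDeriv hpq hq le_rfl ![i, j]
  simp only [iteratedFDeriv_one_apply, iteratedFDeriv_two_apply, Matrix.cons_val_zero,
    Matrix.cons_val_one] at hg hH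
  have hpg (i : Fin d) : HasWeakDeriv volume (EuclideanSpace.single i 1) p (g i) :=
    fun φ hφ => by simpa using hg i φ hφ
  refine ⟨g, H, fun i => ⟨hgm i, hgI i, hpg i⟩, fun i j =>
    ⟨hHm i j, hHI i j, hHq i j, fun φ hφ => ?_⟩⟩
  have hsecond (x : EuclideanSpace ℝ (Fin d)) :
      fderiv ℝ (fun y => fderiv ℝ φ y (EuclideanSpace.single j 1)) x
        (EuclideanSpace.single i 1) =
      fderiv ℝ (fderiv ℝ φ) x (EuclideanSpace.single i 1) (EuclideanSpace.single j 1) := by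
    have hdiff : DifferentiableAt ℝ (fderiv ℝ φ) x :=
      (hφ.contDiff.fderiv_right (m := 1) (by norm_cast)).differentiable (by simp) x
    rw [fderiv_clm_apply hdiff (differentiableAt_const _)]
    simp
  have hpair := hpg i _ (hφ.fderiv_apply (EuclideanSpace.single j 1))
  simp only [hsecond, hH i j φ hφ] at hpair
  linarith

theorem sum_smul_single (v : EuclideanSpace ℝ (Fin d)) :
    ∑ i, v i • EuclideanSpace.single i (1 : ℝ) = v := by
  simpa using (EuclideanSpace.basisFun (Fin d) ℝ).sum_repr v

theorem norm_sum_mul_sum_mul_le (v : EuclideanSpace ℝ (Fin d)) (H : Fin d → Fin d → ℝ) :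
    ‖∑ i, v i * ∑ j, v j * H i j‖ ≤ ‖v‖ ^ 2 * ∑ i, ∑ j, ‖H i j‖ := by
  simp only [Finset.mul_sum]
  refine (norm_sum_le _ _).trans (Finset.sum_le_sum fun i _ => (norm_sum_le _ _).trans
    (Finset.sum_le_sum fun j _ => ?_))
  rw [norm_mul, norm_mul, ← mul_assoc, sq]
  gcongr <;> exact PiLp.norm_apply_le v _

theorem ae_enorm_taylor_le {g : Fin d → EuclideanSpace ℝ (Fin d) → ℝ}
    {H : Fin d → Fin d → EuclideanSpace ℝ (Fin d) → ℝ} (hp : Integrable p)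
    (hg : ∀ i, Measurable (g i) ∧ Integrable (g i) ∧
      HasWeakDeriv volume (EuclideanSpace.single i 1) p (g i))
    (hH : ∀ i j, Measurable (H i j) ∧ Integrable (H i j) ∧
      HasWeakDeriv volume (EuclideanSpace.single j 1) (g i) (H i j))
    (v : EuclideanSpace ℝ (Fin d)) :
    ∀ᵐ x, ‖p (x + v) - p x - ∑ i, v i * g i x‖ₑ ≤
      ∫⁻ t in Set.Ioc (0 : ℝ) 1, ‖∑ i, v i * ∑ j, v j * H i j (x + t • v)‖ₑ := by
  have hgI (i : Fin d) : LocallyIntegrable (g i) volume := (hg i).2.1.locallyIntegrable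
  have hHI (i j : Fin d) : LocallyIntegrable (H i j) volume := (hH i j).2.1.locallyIntegrable
  have hHv (i : Fin d) : Integrable (fun x => ∑ j, v j * H i j x) :=
    integrable_finsetSum _ fun j _ => (hH i j).2.1.const_mul _
  have hpv : HasWeakDeriv volume v p (fun x => ∑ i, v i * g i x) := by
    simpa only [sum_smul_single] using
      HasWeakDeriv.sum_smul hp.locallyIntegrable hgI (fun i => (hg i).2.2) v
  have hgv (i : Fin d) : HasWeakDeriv volume v (g i) (fun x => ∑ j, v j * H i j x) := by
    simpa only [sum_smul_single] using
      HasWeakDeriv.sum_smul (hgI i) (hHI i) (fun j => (hH i j).2.2) v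
  have htaylor := hpv.ae_enorm_sub_sub_le
    (HasWeakDeriv.sum_left hgI (fun i => (hHv i).locallyIntegrable) hgv v) hp
    (integrable_finsetSum _ fun i _ => (hg i).2.1.const_mul _)
    (integrable_finsetSum _ fun i _ => (hHv i).const_mul _)
    (Finset.measurable_fun_sum _ fun i _ => (hg i).1.const_mul _)
    (Finset.measurable_fun_sum _ fun i _ =>
      (Finset.measurable_fun_sum _ fun j _ => (hH i j).1.const_mul _).const_mul _)
  exact htaylor

theorem MemSobolev.exists_taylor (h1 : MemSobolev 2 1 p) (hpq : MemSobolev 2 q p) (hq : 1 ≤ q) :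
    ∃ (g : EuclideanSpace ℝ (Fin d) → EuclideanSpace ℝ (Fin d))
      (G : EuclideanSpace ℝ (Fin d) → ℝ), Measurable g ∧ Measurable G ∧ MemLp G q ∧
      ∀ v, ∀ᵐ x, ‖p (x + v) - p x - ⟪g x, v⟫_ℝ‖ₑ ≤
        ‖v‖ₑ ^ 2 * ∫⁻ t in Set.Ioc (0 : ℝ) 1, ‖G (x + t • v)‖ₑ := by
  obtain ⟨g, H, hg, hH⟩ := h1.exists_gradient_hessian hpq hq
  have hp : Integrable p := memLp_one_iff_integrable.1 h1.1
  refine ⟨fun x => WithLp.toLp 2 fun i => g i x, fun x => ∑ i, ∑ j, ‖H i j x‖, ?_, ?_, ?_,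
    fun v => ?_⟩
  · exact (PiLp.continuous_toLp 2 _).measurable.comp (measurable_pi_lambda _ fun i => (hg i).1)
  · exact Finset.measurable_fun_sum _ fun i _ => Finset.measurable_fun_sum _ fun j _ =>
      (hH i j).1.norm
  · exact memLp_finsetSum _ fun i _ => memLp_finsetSum _ fun j _ => (hH i j).2.2.1.norm
  have htaylor := ae_enorm_taylor_le hp hg (fun i j => ⟨(hH i j).1, (hH i j).2.1, (hH i j).2.2.2⟩) v
  filter_upwards [htaylor] with x hx
  have hinner : ⟪WithLp.toLp 2 fun i => g i x, v⟫_ℝ = ∑ i, v i * g i x := by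
    simp [PiLp.inner_apply]
  rw [hinner, ← lintegral_const_mul' _ _ (by simp)]
  refine hx.trans (lintegral_mono fun t => ?_)
  rw [← enorm_norm v, ← enorm_pow, ← enorm_mul]
  refine enorm_le_iff_norm_le.2 ((norm_sum_mul_sum_mul_le v fun i j => H i j _).trans ?_)
  rw [norm_mul, norm_pow, norm_norm]
  gcongr
  exact le_abs_self _

end Sobolev

/-! ### The bias -/

section Averages

variable {E Y : Type*} [NormedAddCommGroup E] [MeasurableSpace E] [BorelSpace E] [MeasurableSpace Y]
  [SecondCountableTopology E] {ν : Measure E} [SFinite ν] [ν.IsAddRightInvariant] {τ : Measure Y}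

theorem lintegral_rpow_le {q : ℝ} (hq : 1 ≤ q) {f : Y → ℝ≥0∞} (hf : Measurable f) :
    (∫⁻ y, f y ∂τ) ^ q ≤ τ Set.univ ^ (q - 1) * ∫⁻ y, f y ^ q ∂τ := by
  have hq0 : 0 < q := zero_lt_one.trans_le hq
  have h := eLpNorm'_le_eLpNorm'_mul_rpow_measure_univ zero_lt_one hq
    (hf.aestronglyMeasurable (μ := τ))
  simp only [eLpNorm', enorm_eq_self, ENNReal.rpow_one, div_one] at h
  calc (∫⁻ y, f y ∂τ) ^ q
      ≤ ((∫⁻ y, f y ^ q ∂τ) ^ (1 / q) * τ Set.univ ^ (1 - 1 / q)) ^ q := by gcongr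
    _ = τ Set.univ ^ (q - 1) * ∫⁻ y, f y ^ q ∂τ := by
      rw [ENNReal.mul_rpow_of_nonneg _ _ hq0.le, ← ENNReal.rpow_mul, ← ENNReal.rpow_mul,
        one_div_mul_cancel hq0.ne', ENNReal.rpow_one, sub_mul, one_div_mul_cancel hq0.ne',
        one_mul, mul_comm]

variable [SFinite τ]

theorem lintegral_lintegral_comp_add {G : E → ℝ≥0∞} (hG : Measurable G) {a : Y → E}
    (ha : Measurable a) :
    ∫⁻ x, ∫⁻ y, G (x + a y) ∂τ ∂ν = τ Set.univ * ∫⁻ x, G x ∂ν := by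
  rw [lintegral_lintegral_swap (by fun_prop)]
  simp only [lintegral_add_right_eq_self G, lintegral_const, mul_comm]

theorem eLpNorm_lintegral_comp_add_le {q : ℝ≥0∞} (hq : 1 ≤ q) (hq_top : q ≠ ∞) {G : E → ℝ≥0∞}
    (hG : Measurable G) {a : Y → E} (ha : Measurable a) :
    eLpNorm (fun x => ∫⁻ y, G (x + a y) ∂τ) q ν ≤ τ Set.univ * eLpNorm G q ν := by
  have hr : 1 ≤ q.toReal := by simpa using ENNReal.toReal_mono hq_top hq
  have hr0 : 0 < q.toReal := zero_lt_one.trans_le hr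
  have hq0 : q ≠ 0 := (zero_lt_one.trans_le hq).ne'
  simp only [eLpNorm_eq_lintegral_rpow_enorm_toReal hq0 hq_top, enorm_eq_self]
  set r := q.toReal
  calc (∫⁻ x, (∫⁻ y, G (x + a y) ∂τ) ^ r ∂ν) ^ (1 / r)
      ≤ (∫⁻ x, τ Set.univ ^ (r - 1) * ∫⁻ y, G (x + a y) ^ r ∂τ ∂ν) ^ (1 / r) := by
        gcongr with x
        exact lintegral_rpow_le hr (by fun_prop)
    _ = (τ Set.univ ^ (r - 1) * (τ Set.univ * ∫⁻ x, G x ^ r ∂ν)) ^ (1 / r) := by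
        rw [lintegral_const_mul _ (Measurable.lintegral_prod_right' (f := fun z : E × Y =>
          G (z.1 + a z.2) ^ r) (by fun_prop)),
          lintegral_lintegral_comp_add (hG.pow_const r) ha]
    _ = (τ Set.univ ^ r * ∫⁻ x, G x ^ r ∂ν) ^ (1 / r) := by
        have hpow := ENNReal.rpow_add_of_nonneg (x := τ Set.univ) (r - 1) 1 (sub_nonneg.2 hr)
          zero_le_one
        rw [sub_add_cancel, ENNReal.rpow_one] at hpow
        rw [← mul_assoc, ← hpow]
    _ = τ Set.univ * (∫⁻ x, G x ^ r ∂ν) ^ (1 / r) := by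
        rw [ENNReal.mul_rpow_of_nonneg _ _ (by positivity), ← ENNReal.rpow_mul,
          mul_one_div_cancel hr0.ne', ENNReal.rpow_one]

end Averages

section Bias

variable {d : ℕ} {K p : EuclideanSpace ℝ (Fin d) → ℝ}

/-- A kernel of order two: total mass one, vanishing first moment, finite absolute second moment. -/
structure IsSecondOrderKernel (K : EuclideanSpace ℝ (Fin d) → ℝ) : Prop where
  integrable : Integrable K
  integral_eq_one : ∫ u, K u = 1
  integral_smul_eq_zero : ∫ u, K u • u = 0
  integrable_sq_norm_mul_abs : Integrable fun u => ‖u‖ ^ 2 * |K u|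

theorem IsSecondOrderKernel.integrable_smul (hK : IsSecondOrderKernel K) :
    Integrable fun u => K u • u := by
  refine (hK.integrable.norm.add hK.integrable_sq_norm_mul_abs).mono'
    (hK.integrable.1.smul aestronglyMeasurable_id) (ae_of_all _ fun u => ?_)
  rw [norm_smul, Pi.add_apply, Real.norm_eq_abs]
  nlinarith [mul_nonneg (abs_nonneg (K u)) (sq_nonneg (‖u‖ - 1)),
    mul_nonneg (abs_nonneg (K u)) (sq_nonneg ‖u‖), abs_nonneg (K u)]

/-- The mean at `x` of the kernel density estimator with bandwidth `h` of the density `p`. -/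
def smoothing (K p : EuclideanSpace ℝ (Fin d) → ℝ) (h : ℝ) (x : EuclideanSpace ℝ (Fin d)) : ℝ :=
  ∫ u, K u * p (x + h • u)

theorem IsSecondOrderKernel.smoothing_sub_eq_integral (hK : IsSecondOrderKernel K) {h : ℝ}
    {x : EuclideanSpace ℝ (Fin d)} (hx : Integrable fun u => K u * p (x + h • u))
    (y : EuclideanSpace ℝ (Fin d)) :
    smoothing K p h x - p x = ∫ u, K u * (p (x + h • u) - p x - ⟪y, h • u⟫_ℝ) := by
  have hsplit (u : EuclideanSpace ℝ (Fin d)) : K u * (p (x + h • u) - p x - ⟪y, h • u⟫_ℝ) =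
      K u * p (x + h • u) - K u * p x - h * ⟪y, K u • u⟫_ℝ := by
    rw [inner_smul_right, inner_smul_right]
    ring
  have hconst : Integrable fun u => K u * p x := hK.integrable.mul_const _
  have hinner : Integrable fun u => ⟪y, K u • u⟫_ℝ := hK.integrable_smul.const_inner _
  have hdiff : Integrable fun u => K u * p (x + h • u) - K u * p x := hx.sub hconst
  simp only [hsplit]
  rw [integral_sub hdiff (hinner.const_mul h), integral_sub hx hconst, integral_mul_const,
    hK.integral_eq_one, integral_const_mul, integral_inner hK.integrable_smul,
    hK.integral_smul_eq_zero, inner_zero_right, smoothing]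
  ring

/-- The measure `‖u‖² |K u| du`, against which the Taylor remainder of `p` is averaged. -/
def secondMomentMeasure (K : EuclideanSpace ℝ (Fin d) → ℝ) :
    Measure (EuclideanSpace ℝ (Fin d)) :=
  volume.withDensity fun u => ‖u‖ₑ ^ 2 * ‖K u‖ₑ

theorem IsSecondOrderKernel.isFiniteMeasure_secondMomentMeasure (hK : IsSecondOrderKernel K) :
    IsFiniteMeasure (secondMomentMeasure K) := by
  refine isFiniteMeasure_withDensity (ne_of_eq_of_ne ?_ hK.integrable_sq_norm_mul_abs.2.ne)
  simp [enorm_mul, enorm_pow]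

instance : SFinite (secondMomentMeasure K) := by
  unfold secondMomentMeasure
  infer_instance

theorem ae_ae_enorm_taylor_le (hpm : Measurable p)
    {g : EuclideanSpace ℝ (Fin d) → EuclideanSpace ℝ (Fin d)} {G : EuclideanSpace ℝ (Fin d) → ℝ}
    (hg : Measurable g) (hG : Measurable G)
    (hT : ∀ v, ∀ᵐ x, ‖p (x + v) - p x - ⟪g x, v⟫_ℝ‖ₑ ≤
      ‖v‖ₑ ^ 2 * ∫⁻ t in Set.Ioc (0 : ℝ) 1, ‖G (x + t • v)‖ₑ) (h : ℝ) :
    ∀ᵐ x, ∀ᵐ u, ‖p (x + h • u) - p x - ⟪g x, h • u⟫_ℝ‖ₑ ≤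
      ‖h • u‖ₑ ^ 2 * ∫⁻ t in Set.Ioc (0 : ℝ) 1, ‖G (x + t • h • u)‖ₑ := by
  refine (Measure.ae_ae_comm (μ := volume) (ν := volume) (p := fun u x =>
    ‖p (x + h • u) - p x - ⟪g x, h • u⟫_ℝ‖ₑ ≤
      ‖h • u‖ₑ ^ 2 * ∫⁻ t in Set.Ioc (0 : ℝ) 1, ‖G (x + t • h • u)‖ₑ) (measurableSet_le ?_ ?_)).1
      (ae_of_all _ fun u => hT (h • u))
  · fun_prop
  · exact Measurable.mul (by fun_prop) (Measurable.lintegral_prod_right'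
      (f := fun w : (EuclideanSpace ℝ (Fin d) × EuclideanSpace ℝ (Fin d)) × ℝ =>
        ‖G (w.1.2 + w.2 • h • w.1.1)‖ₑ) (by fun_prop))

theorem IsSecondOrderKernel.ae_enorm_smoothing_sub_le (hK : IsSecondOrderKernel K)
    (hKm : Measurable K) (hpm : Measurable p) (hpI : Integrable p)
    {g : EuclideanSpace ℝ (Fin d) → EuclideanSpace ℝ (Fin d)} {G : EuclideanSpace ℝ (Fin d) → ℝ}
    (hg : Measurable g) (hG : Measurable G)
    (hT : ∀ v, ∀ᵐ x, ‖p (x + v) - p x - ⟪g x, v⟫_ℝ‖ₑ ≤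
      ‖v‖ₑ ^ 2 * ∫⁻ t in Set.Ioc (0 : ℝ) 1, ‖G (x + t • v)‖ₑ) (h : ℝ) :
    ∀ᵐ x, ‖smoothing K p h x - p x‖ₑ ≤ ‖h‖ₑ ^ 2 * ∫⁻ y, ‖G (x + y.2 • h • y.1)‖ₑ
      ∂((secondMomentMeasure K).prod (volume.restrict (Set.Ioc (0 : ℝ) 1))) := by
  filter_upwards [ae_ae_enorm_taylor_le hpm hg hG hT h, (integrable_mul_comp_add hK.integrable hpI
    (measurable_const_smul h)).prod_right_ae] with x htaylor hint
  rw [hK.smoothing_sub_eq_integral hint (g x), lintegral_prod _ (by fun_prop),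
    secondMomentMeasure, lintegral_withDensity_eq_lintegral_mul _ (by fun_prop)
    (Measurable.lintegral_prod_right' (f := fun w : EuclideanSpace ℝ (Fin d) × ℝ =>
      ‖G (x + w.2 • h • w.1)‖ₑ) (by fun_prop)), ← lintegral_const_mul' _ _ (by simp)]
  refine (enorm_integral_le_lintegral_enorm _).trans (lintegral_mono_ae ?_)
  filter_upwards [htaylor] with u hu
  calc ‖K u * (p (x + h • u) - p x - ⟪g x, h • u⟫_ℝ)‖ₑ
      ≤ ‖K u‖ₑ * (‖h • u‖ₑ ^ 2 * ∫⁻ t in Set.Ioc (0 : ℝ) 1, ‖G (x + t • h • u)‖ₑ) := by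
        rw [enorm_mul]
        gcongr
    _ = _ := by
        rw [enorm_smul, Pi.mul_apply]
        ring

theorem IsSecondOrderKernel.exists_eLpNorm_smoothing_sub_le (hK : IsSecondOrderKernel K)
    (hKm : Measurable K) (hpm : Measurable p) {q : ℝ≥0∞} (hq : 1 ≤ q) (hq_top : q ≠ ∞)
    (hp1 : MemSobolev 2 1 p) (hpq : MemSobolev 2 q p) :
    ∃ A : ℝ, 0 ≤ A ∧ ∀ h : ℝ,
      eLpNorm (fun x => smoothing K p h x - p x) q volume ≤ ENNReal.ofReal (A * h ^ 2) := by
  obtain ⟨g, G, hg, hG, hGq, hT⟩ := hp1.exists_taylor hpq hq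
  have := hK.isFiniteMeasure_secondMomentMeasure
  set τ := (secondMomentMeasure K).prod (volume.restrict (Set.Ioc (0 : ℝ) 1))
  have hfin : τ Set.univ * eLpNorm G q volume ≠ ∞ :=
    ENNReal.mul_ne_top (measure_ne_top _ _) hGq.2.ne
  refine ⟨(τ Set.univ * eLpNorm G q volume).toReal, ENNReal.toReal_nonneg, fun h => ?_⟩
  have hshift : Measurable fun y : EuclideanSpace ℝ (Fin d) × ℝ => y.2 • h • y.1 := by fun_prop
  have hbias := hK.ae_enorm_smoothing_sub_le hKm hpm (memLp_one_iff_integrable.1 hp1.1) hg hG hT h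
  calc eLpNorm (fun x => smoothing K p h x - p x) q volume
      ≤ ENNReal.ofReal (h ^ 2) * eLpNorm (fun x => ∫⁻ y, ‖G (x + y.2 • h • y.1)‖ₑ ∂τ) q volume := by
        rw [← Real.enorm_of_nonneg (sq_nonneg h), enorm_pow]
        exact eLpNorm_le_mul_eLpNorm_of_ae_le_mul' (c := ‖h‖₊ ^ 2)
          (by simpa [enorm_eq_nnnorm] using hbias) q
    _ ≤ ENNReal.ofReal (h ^ 2) * (τ Set.univ * eLpNorm G q volume) := by
        gcongr
        rw [← eLpNorm_enorm G]
        exact eLpNorm_lintegral_comp_add_le hq hq_top hG.enorm hshift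
    _ = _ := by
        rw [ENNReal.ofReal_mul ENNReal.toReal_nonneg, ENNReal.ofReal_toReal hfin, mul_comm]

end Bias

/-! ### The stochastic error -/

section SquareIntegrals

variable {α : Type*} [MeasurableSpace α] {ν : Measure α} {f w : α → ℝ≥0∞}

theorem sq_lintegral_le (hf : Measurable f) :
    (∫⁻ x, f x ∂ν) ^ 2 ≤ ν Set.univ * ∫⁻ x, f x ^ 2 ∂ν := by
  have h := lintegral_rpow_le (τ := ν) one_le_two hf
  rwa [show (2 : ℝ) - 1 = 1 by norm_num, ENNReal.rpow_one, ENNReal.rpow_two,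
    funext fun x => ENNReal.rpow_two (f x)] at h

theorem sq_lintegral_le_lintegral_inv_mul (hf : Measurable f) (hw : Measurable w)
    (hw0 : ∀ x, w x ≠ 0) (hw_top : ∀ x, w x ≠ ∞) :
    (∫⁻ x, f x ∂ν) ^ 2 ≤ (∫⁻ x, (w x)⁻¹ ∂ν) * ∫⁻ x, w x * f x ^ 2 ∂ν := by
  have hcancel (x : α) : (w x)⁻¹ * (w x * f x) = f x :=
    ENNReal.inv_mul_cancel_left (hw0 x) (hw_top x)
  have hcancel_sq (x : α) : (w x)⁻¹ * (w x * f x) ^ 2 = w x * f x ^ 2 := by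
    rw [sq, ← mul_assoc, hcancel]
    ring
  have hw_inv : Measurable fun x => (w x)⁻¹ := hw.inv
  have hwf : Measurable fun x => w x * f x := hw.mul hf
  have h := sq_lintegral_le (ν := ν.withDensity fun x => (w x)⁻¹) hwf
  rw [lintegral_withDensity_eq_lintegral_mul _ hw_inv hwf,
    lintegral_withDensity_eq_lintegral_mul _ hw_inv (hwf.pow_const 2),
    withDensity_apply _ MeasurableSet.univ, Measure.restrict_univ] at h
  simpa only [Pi.mul_apply, hcancel, hcancel_sq] using h

theorem lintegral_enorm_sq_eq_ofReal_integral {f : α → ℝ} (hf : MemLp f 2 ν) :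
    ∫⁻ x, ‖f x‖ₑ ^ 2 ∂ν = ENNReal.ofReal (∫ x, f x ^ 2 ∂ν) := by
  rw [ofReal_integral_eq_lintegral_ofReal hf.integrable_sq (ae_of_all _ fun x => sq_nonneg _)]
  simp only [← Real.enorm_of_nonneg (sq_nonneg _), enorm_pow]

theorem lintegral_enorm_sq_ne_top_iff {f : α → ℝ} (hf : AEStronglyMeasurable f ν) :
    ∫⁻ x, ‖f x‖ₑ ^ 2 ∂ν ≠ ∞ ↔ MemLp f 2 ν := by
  rw [MemLp, eLpNorm_lt_top_iff_lintegral_rpow_enorm_lt_top two_ne_zero ENNReal.ofNat_ne_top]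
  simp [hf, lt_top_iff_ne_top]

end SquareIntegrals

namespace HasLinearVariance

variable {Ω α : Type*} [MeasurableSpace Ω] [MeasurableSpace α] {μ : Measure Ω}
  [IsProbabilityMeasure μ] {P : Measure α} {Z : ℕ → Ω → α}

theorem isProbabilityMeasure (hZ : HasLinearVariance μ P Z) : IsProbabilityMeasure P :=
  (hZ.measurePreserving 0).map_eq ▸
    Measure.isProbabilityMeasure_map (hZ.measurePreserving 0).aemeasurable

theorem lintegral_enorm_average_sub_sq (hZ : HasLinearVariance μ P Z) {f : α → ℝ}
    (hf : MemLp f 2 P) {N : ℕ} (hN : 0 < N) :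
    ∫⁻ ω, ‖1 / (N : ℝ) * ∑ k ∈ Finset.range N, f (Z k ω) - ∫ x, f x ∂P‖ₑ ^ 2 ∂μ =
      ENNReal.ofReal ((1 / (N : ℝ)) ^ 2 * Var[fun ω => ∑ k ∈ Finset.range N, f (Z k ω); μ]) := by
  have := hZ.isProbabilityMeasure
  have h_memLp : MemLp (fun ω => 1 / (N : ℝ) * ∑ k ∈ Finset.range N, f (Z k ω)) 2 μ :=
    (memLp_finsetSum _ fun k _ =>
      hf.comp_measurePreserving (hZ.measurePreserving k)).const_mul _
  have h_mean : ∫ ω, 1 / (N : ℝ) * ∑ k ∈ Finset.range N, f (Z k ω) ∂μ = ∫ x, f x ∂P := by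
    rw [integral_const_mul, integral_sum_comp hZ.measurePreserving (hf.integrable one_le_two)]
    field_simp
  rw [← variance_const_mul, ofReal_variance h_memLp, evariance, h_mean]

theorem exists_lintegral_enorm_average_sub_sq_le (hZ : HasLinearVariance μ P Z) :
    ∃ C : ℝ, 0 < C ∧ ∀ f : α → ℝ, Measurable f → ∀ N : ℕ, 0 < N →
      ∫⁻ ω, ‖1 / (N : ℝ) * ∑ k ∈ Finset.range N, f (Z k ω) - ∫ x, f x ∂P‖ₑ ^ 2 ∂μ ≤
        ENNReal.ofReal (C / N) * ∫⁻ x, ‖f x‖ₑ ^ 2 ∂P := by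
  obtain ⟨C, hC0, hC⟩ := hZ.exists_variance_sum_le
  refine ⟨C + 1, by positivity, fun f hf N hN => ?_⟩
  by_cases hf2 : MemLp f 2 P
  · rw [hZ.lintegral_enorm_average_sub_sq hf2 hN, lintegral_enorm_sq_eq_ofReal_integral hf2,
      ← ENNReal.ofReal_mul (by positivity)]
    refine ENNReal.ofReal_le_ofReal ?_
    have : 0 ≤ ∫ x, f x ^ 2 ∂P := integral_nonneg fun x => sq_nonneg _
    calc (1 / (N : ℝ)) ^ 2 * Var[fun ω => ∑ k ∈ Finset.range N, f (Z k ω); μ]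
        ≤ (1 / (N : ℝ)) ^ 2 * ((C + 1) * N * ∫ x, f x ^ 2 ∂P) := by
          gcongr
          refine (hC f hf hf2 N).trans ?_
          gcongr
          linarith
      _ = (C + 1) / N * ∫ x, f x ^ 2 ∂P := by field_simp
  · rw [not_ne_iff.1 (mt (lintegral_enorm_sq_ne_top_iff hf.aestronglyMeasurable).1 hf2),
      ENNReal.mul_top (ENNReal.ofReal_pos.2 (by positivity)).ne']
    exact le_top

end HasLinearVariance

section ChangeOfVariables

variable {E : Type*} [NormedAddCommGroup E] [NormedSpace ℝ E] [FiniteDimensional ℝ E]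
  [MeasurableSpace E] [BorelSpace E] {ν : Measure E} [ν.IsAddHaarMeasure]

theorem lintegral_comp_add_smul {F : E → ℝ≥0∞} (hF : Measurable F) {b : ℝ} (hb : 0 < b) (x : E) :
    ∫⁻ z, F z ∂ν = ENNReal.ofReal (b ^ Module.finrank ℝ E) * ∫⁻ u, F (x + b • u) ∂ν := by
  have h_map : ∫⁻ u, F (x + b • u) ∂ν = ∫⁻ z, F (x + z) ∂(ν.map (b • ·)) :=
    (lintegral_map (hF.comp (measurable_const_add x)) (measurable_const_smul b)).symm
  rw [h_map, Measure.map_addHaar_smul ν hb.ne', lintegral_smul_measure, lintegral_add_left_eq_self,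
    smul_eq_mul, ← mul_assoc, ← ENNReal.ofReal_mul (by positivity), abs_of_pos (by positivity),
    mul_inv_cancel₀ (by positivity), ENNReal.ofReal_one, one_mul]

theorem integral_comp_add_smul (F : E → ℝ) {b : ℝ} (hb : 0 < b) (x : E) :
    ∫ z, F z ∂ν = b ^ Module.finrank ℝ E * ∫ u, F (x + b • u) ∂ν := by
  rw [Measure.integral_comp_smul ν (fun z => F (x + z)) b, integral_add_left_eq_self,
    smul_eq_mul, ← mul_assoc, abs_of_pos (by positivity), mul_inv_cancel₀ (by positivity), one_mul]

end ChangeOfVariables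

section ScaledKernel

variable {d : ℕ} {K p : EuclideanSpace ℝ (Fin d) → ℝ} {b : ℝ}

theorem measurable_scaledKernel (hK : Measurable K) (b : ℝ) :
    Measurable fun z : EuclideanSpace ℝ (Fin d) × EuclideanSpace ℝ (Fin d) =>
      scaledKernel K b z.1 z.2 := by
  unfold scaledKernel
  fun_prop

theorem scaledKernel_add_smul (hb : 0 < b) (x u : EuclideanSpace ℝ (Fin d)) :
    scaledKernel K b (x + b • u) x = 1 / b ^ d * K u := by
  rw [scaledKernel, add_sub_cancel_left, inv_smul_smul₀ hb.ne']

theorem integral_scaledKernel (hp : 0 ≤ᵐ[volume] p) (hpm : Measurable p) (hb : 0 < b)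
    (x : EuclideanSpace ℝ (Fin d)) :
    ∫ z, scaledKernel K b z x ∂(volume.withDensity fun y => ENNReal.ofReal (p y)) =
      smoothing K p b x := by
  have h_density : ∀ᵐ z, (ENNReal.ofReal (p z)).toReal • scaledKernel K b z x =
      p z * scaledKernel K b z x := by
    filter_upwards [hp] with z hz
    rw [ENNReal.toReal_ofReal hz, smul_eq_mul]
  rw [integral_withDensity_eq_integral_toReal_smul (by fun_prop) (by simp),
    integral_congr_ae h_density, integral_comp_add_smul _ hb x, finrank_euclideanSpace_fin,
    ← integral_const_mul, smoothing]
  refine integral_congr_ae (ae_of_all _ fun u => ?_)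
  simp only [scaledKernel_add_smul hb]
  field_simp

/-- The integral `∫ K(u)² p(x + b u) du`, which governs the variance at `x` of the kernel density
estimator with bandwidth `b` of the density `p`. -/
def sqSmoothing (K p : EuclideanSpace ℝ (Fin d) → ℝ) (b : ℝ) (x : EuclideanSpace ℝ (Fin d)) :
    ℝ≥0∞ :=
  ∫⁻ u, ‖K u‖ₑ ^ 2 * ENNReal.ofReal (p (x + b • u))

theorem lintegral_enorm_scaledKernel_sq (hKm : Measurable K) (hpm : Measurable p) (hb : 0 < b)
    (x : EuclideanSpace ℝ (Fin d)) :
    ∫⁻ z, ‖scaledKernel K b z x‖ₑ ^ 2 ∂(volume.withDensity fun y => ENNReal.ofReal (p y)) =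
      ENNReal.ofReal (1 / b ^ d) * sqSmoothing K p b x := by
  have h_meas : Measurable fun z => ‖scaledKernel K b z x‖ₑ ^ 2 :=
    ((measurable_scaledKernel hKm b).comp measurable_prodMk_right).enorm.pow_const 2
  have h_const : ENNReal.ofReal (b ^ d) * ENNReal.ofReal (1 / b ^ d) = 1 := by
    rw [← ENNReal.ofReal_mul (by positivity), mul_one_div_cancel (by positivity),
      ENNReal.ofReal_one]
  rw [lintegral_withDensity_eq_lintegral_mul _ (by fun_prop) h_meas,
    lintegral_comp_add_smul (hpm.ennreal_ofReal.mul h_meas) hb x, finrank_euclideanSpace_fin,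
    sqSmoothing, ← lintegral_const_mul' _ _ (by simp), ← lintegral_const_mul' _ _ (by simp)]
  refine lintegral_congr fun u => ?_
  rw [Pi.mul_apply, scaledKernel_add_smul hb, enorm_mul, mul_pow,
    Real.enorm_of_nonneg (by positivity : 0 ≤ 1 / b ^ d)]
  calc _ = ENNReal.ofReal (b ^ d) * ENNReal.ofReal (1 / b ^ d) *
        (ENNReal.ofReal (1 / b ^ d) * (‖K u‖ₑ ^ 2 * ENNReal.ofReal (p (x + b • u)))) := by ring
    _ = _ := by rw [h_const, one_mul]

theorem lintegral_mul_sqSmoothing (hKm : Measurable K) (hpm : Measurable p) (b : ℝ)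
    {w : EuclideanSpace ℝ (Fin d) → ℝ≥0∞} (hw : Measurable w) :
    ∫⁻ x, w x * sqSmoothing K p b x =
      ∫⁻ u, ‖K u‖ₑ ^ 2 * ∫⁻ x, w x * ENNReal.ofReal (p (x + b • u)) := by
  calc ∫⁻ x, w x * sqSmoothing K p b x
      = ∫⁻ x, ∫⁻ u, w x * (‖K u‖ₑ ^ 2 * ENNReal.ofReal (p (x + b • u))) := by
        refine lintegral_congr fun x => ?_
        rw [sqSmoothing, lintegral_const_mul _ (by fun_prop)]
    _ = ∫⁻ u, ∫⁻ x, w x * (‖K u‖ₑ ^ 2 * ENNReal.ofReal (p (x + b • u))) :=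
        lintegral_lintegral_swap (by fun_prop)
    _ = _ := by
        refine lintegral_congr fun u => ?_
        simp only [mul_left_comm (w _)]
        rw [lintegral_const_mul _ (by fun_prop)]

theorem lintegral_sqSmoothing (hKm : Measurable K) (hpm : Measurable p) (b : ℝ) :
    ∫⁻ x, sqSmoothing K p b x = (∫⁻ u, ‖K u‖ₑ ^ 2) * ∫⁻ x, ENNReal.ofReal (p x) := by
  have h := lintegral_mul_sqSmoothing hKm hpm b (w := 1) measurable_one
  simp only [Pi.one_apply, one_mul,
    lintegral_add_right_eq_self fun x => ENNReal.ofReal (p x)] at h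
  rw [h, lintegral_mul_const _ (by fun_prop)]

end ScaledKernel

section Weight

theorem one_add_norm_le_mul_one_add_norm_add {E : Type*} [SeminormedAddGroup E] (x v : E) :
    1 + ‖x‖ ≤ (1 + ‖v‖) * (1 + ‖x + v‖) := by
  have h : ‖x‖ ≤ ‖x + v‖ + ‖v‖ := by simpa using norm_sub_le (x + v) v
  nlinarith [mul_nonneg (norm_nonneg v) (norm_nonneg (x + v))]

variable {d : ℕ} {K p : EuclideanSpace ℝ (Fin d) → ℝ} {s : ℝ}

/-- The weight `(1 + ‖x‖)ˢ`. -/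
def polyWeight (s : ℝ) (x : EuclideanSpace ℝ (Fin d)) : ℝ≥0∞ :=
  ENNReal.ofReal ((1 + ‖x‖) ^ s)

@[fun_prop]
theorem measurable_polyWeight : Measurable (polyWeight s : EuclideanSpace ℝ (Fin d) → ℝ≥0∞) := by
  unfold polyWeight
  fun_prop

theorem polyWeight_le_mul_polyWeight_add (hs : 0 ≤ s) (x v : EuclideanSpace ℝ (Fin d)) :
    polyWeight s x ≤ polyWeight s v * polyWeight s (x + v) := by
  unfold polyWeight
  rw [← ENNReal.ofReal_mul (by positivity), ← Real.mul_rpow (by positivity) (by positivity)]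
  gcongr
  exact one_add_norm_le_mul_one_add_norm_add x v

theorem polyWeight_smul_le (hs : 0 ≤ s) {b : ℝ} (hb : |b| ≤ 1) (u : EuclideanSpace ℝ (Fin d)) :
    polyWeight s (b • u) ≤ polyWeight s u := by
  unfold polyWeight
  rw [norm_smul, Real.norm_eq_abs]
  gcongr
  exact mul_le_of_le_one_left (norm_nonneg u) hb

theorem lintegral_polyWeight_mul_comp_add_smul_le (hs : 0 ≤ s) {b : ℝ} (hb : |b| ≤ 1)
    {f : EuclideanSpace ℝ (Fin d) → ℝ≥0∞} (hf : Measurable f) (u : EuclideanSpace ℝ (Fin d)) :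
    ∫⁻ x, polyWeight s x * f (x + b • u) ≤ polyWeight s u * ∫⁻ x, polyWeight s x * f x := by
  rw [← lintegral_add_right_eq_self (fun x => polyWeight s x * f x) (b • u),
    ← lintegral_const_mul _ (by fun_prop)]
  refine lintegral_mono fun x => ?_
  rw [← mul_assoc]
  gcongr
  exact (polyWeight_le_mul_polyWeight_add hs x (b • u)).trans
    (mul_le_mul_left (polyWeight_smul_le hs hb u) _)

theorem lintegral_polyWeight_mul_sqSmoothing_le (hKm : Measurable K) (hpm : Measurable p)
    (hs : 0 ≤ s) {b : ℝ} (hb : |b| ≤ 1) :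
    ∫⁻ x, polyWeight s x * sqSmoothing K p b x ≤
      (∫⁻ u, polyWeight s u * ‖K u‖ₑ ^ 2) * ∫⁻ x, polyWeight s x * ENNReal.ofReal (p x) := by
  rw [lintegral_mul_sqSmoothing hKm hpm b measurable_polyWeight,
    ← lintegral_mul_const _ (by fun_prop)]
  refine lintegral_mono fun u => ?_
  rw [mul_comm (polyWeight s u), mul_assoc]
  gcongr
  exact lintegral_polyWeight_mul_comp_add_smul_le hs hb (by fun_prop) u

theorem inv_polyWeight (x : EuclideanSpace ℝ (Fin d)) : (polyWeight s x)⁻¹ = polyWeight (-s) x := by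
  rw [polyWeight, polyWeight, Real.rpow_neg (by positivity),
    ENNReal.ofReal_inv_of_pos (by positivity)]

theorem lintegral_polyWeight_neg_ne_top (hs : (d : ℝ) < s) :
    ∫⁻ x : EuclideanSpace ℝ (Fin d), polyWeight (-s) x ≠ ∞ :=
  (integrable_one_add_norm (by rwa [finrank_euclideanSpace_fin])).lintegral_lt_top.ne

theorem lintegral_polyWeight_mul_ne_top {C m : ℝ} (hs : (d : ℝ) < m - s)
    (hp : ∀ᵐ x, p x ≤ C * (1 + ‖x‖) ^ (-m)) :
    ∫⁻ x, polyWeight s x * ENNReal.ofReal (p x) ≠ ∞ := by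
  have h_int : Integrable fun x : EuclideanSpace ℝ (Fin d) => C * (1 + ‖x‖) ^ (-(m - s)) :=
    (integrable_one_add_norm (by rwa [finrank_euclideanSpace_fin])).const_mul C
  refine ne_top_of_le_ne_top h_int.lintegral_lt_top.ne (lintegral_mono_ae ?_)
  filter_upwards [hp] with x hx
  rw [polyWeight, ← ENNReal.ofReal_mul (by positivity)]
  refine ENNReal.ofReal_le_ofReal ?_
  calc (1 + ‖x‖) ^ s * p x ≤ (1 + ‖x‖) ^ s * (C * (1 + ‖x‖) ^ (-m)) := by gcongr
    _ = C * (1 + ‖x‖) ^ (-(m - s)) := by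
      rw [mul_left_comm, ← Real.rpow_add (by positivity)]
      congr 2
      ring

end Weight

/-! ### The mean integrated errors -/

section Decomposition

variable {Ω : Type*} [MeasurableSpace Ω] {μ : Measure Ω} {d : ℕ}
  {q q' : Ω → EuclideanSpace ℝ (Fin d) → ℝ} {m p p' : EuclideanSpace ℝ (Fin d) → ℝ}

theorem MIAE_eq_lintegral_enorm : MIAE μ q p = ∫⁻ ω, ∫⁻ x, ‖q ω x - p x‖ₑ ∂volume ∂μ := by
  simp only [MIAE, Real.enorm_eq_ofReal_abs]

theorem MISE_eq_lintegral_enorm_sq : MISE μ q p = ∫⁻ ω, ∫⁻ x, ‖q ω x - p x‖ₑ ^ 2 ∂volume ∂μ := by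
  simp only [MISE, ← enorm_pow, Real.enorm_of_nonneg (sq_nonneg _)]

theorem MIAE_congr_ae (hq : ∀ ω, q ω =ᵐ[volume] q' ω) (hp : p =ᵐ[volume] p') :
    MIAE μ q p = MIAE μ q' p' := by
  refine lintegral_congr fun ω => lintegral_congr_ae ?_
  filter_upwards [hq ω, hp] with x hqx hpx
  rw [hqx, hpx]

theorem MISE_congr_ae (hq : ∀ ω, q ω =ᵐ[volume] q' ω) (hp : p =ᵐ[volume] p') :
    MISE μ q p = MISE μ q' p' := by
  refine lintegral_congr fun ω => lintegral_congr_ae ?_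
  filter_upwards [hq ω, hp] with x hqx hpx
  rw [hqx, hpx]

theorem enorm_sub_sq_le (a b c : ℝ) : ‖a - c‖ₑ ^ 2 ≤ 2 * ‖a - b‖ₑ ^ 2 + 2 * ‖b - c‖ₑ ^ 2 := by
  have h_two : (2 : ℝ≥0∞) = ENNReal.ofReal 2 := (ENNReal.ofReal_ofNat 2).symm
  simp only [← enorm_pow, Real.enorm_of_nonneg (sq_nonneg _), h_two]
  rw [← ENNReal.ofReal_mul zero_le_two, ← ENNReal.ofReal_mul zero_le_two,
    ← ENNReal.ofReal_add (by positivity) (by positivity)]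
  exact ENNReal.ofReal_le_ofReal (by nlinarith [sq_nonneg (a - b - (b - c))])

variable [IsProbabilityMeasure μ]

theorem lintegral_lintegral_add_const {f : Ω × EuclideanSpace ℝ (Fin d) → ℝ≥0∞}
    {g : EuclideanSpace ℝ (Fin d) → ℝ≥0∞} (hf : Measurable f) (hg : Measurable g) :
    ∫⁻ ω, ∫⁻ x, (f (ω, x) + g x) ∂volume ∂μ =
      (∫⁻ x, ∫⁻ ω, f (ω, x) ∂μ ∂volume) + ∫⁻ x, g x := by
  rw [lintegral_lintegral_swap (by fun_prop)]
  simp only [lintegral_add_right _ measurable_const, lintegral_const, measure_univ, mul_one]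
  rw [lintegral_add_right _ hg]

theorem MIAE_le_add (hq : Measurable fun z : Ω × EuclideanSpace ℝ (Fin d) => q z.1 z.2)
    (hm : Measurable m) (hp : Measurable p) :
    MIAE μ q p ≤ (∫⁻ x, ∫⁻ ω, ‖q ω x - m x‖ₑ ∂μ ∂volume) + ∫⁻ x, ‖m x - p x‖ₑ := by
  rw [MIAE_eq_lintegral_enorm, ← lintegral_lintegral_add_const
    (f := fun z => ‖q z.1 z.2 - m z.2‖ₑ) (by fun_prop) (by fun_prop)]
  gcongr with ω x
  rw [← sub_add_sub_cancel _ (m x) _]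
  exact enorm_add_le _ _

theorem MISE_le_add (hq : Measurable fun z : Ω × EuclideanSpace ℝ (Fin d) => q z.1 z.2)
    (hm : Measurable m) (hp : Measurable p) :
    MISE μ q p ≤
      2 * (∫⁻ x, ∫⁻ ω, ‖q ω x - m x‖ₑ ^ 2 ∂μ ∂volume) + 2 * ∫⁻ x, ‖m x - p x‖ₑ ^ 2 := by
  simp only [← lintegral_const_mul' 2 _ ENNReal.ofNat_ne_top]
  rw [MISE_eq_lintegral_enorm_sq, ← lintegral_lintegral_add_const
    (f := fun z => 2 * ‖q z.1 z.2 - m z.2‖ₑ ^ 2) (by fun_prop) (by fun_prop)]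
  gcongr with ω x
  exact enorm_sub_sq_le _ _ _

end Decomposition

section Errors

variable {Ω : Type*} {d N : ℕ} {K K' p : EuclideanSpace ℝ (Fin d) → ℝ}
  {b : ℝ} {Z : ℕ → Ω → EuclideanSpace ℝ (Fin d)}

theorem lintegral_enorm_scaledKernel (hKm : Measurable K) (hb : 0 < b)
    (z : EuclideanSpace ℝ (Fin d)) : ∫⁻ x, ‖scaledKernel K b z x‖ₑ = ∫⁻ u, ‖K u‖ₑ := by
  have h_meas : Measurable fun x => ‖scaledKernel K b z x‖ₑ :=
    ((measurable_scaledKernel hKm b).comp measurable_prodMk_left).enorm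
  have h_eq (u : EuclideanSpace ℝ (Fin d)) : scaledKernel K b z (z + b • u) =
      1 / b ^ d * K (-u) := by
    rw [scaledKernel, sub_add_cancel_left, smul_neg, inv_smul_smul₀ hb.ne']
  rw [lintegral_comp_add_smul h_meas hb z, finrank_euclideanSpace_fin]
  simp only [h_eq, enorm_mul]
  rw [lintegral_const_mul' _ _ enorm_ne_top, lintegral_neg_eq_self fun u => ‖K u‖ₑ, ← mul_assoc,
    Real.enorm_of_nonneg (by positivity), ← ENNReal.ofReal_mul (by positivity),
    mul_one_div_cancel (by positivity), ENNReal.ofReal_one, one_mul]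

theorem lintegral_enorm_kde_le (hKm : Measurable K) (hb : 0 < b) (ω : Ω) :
    ∫⁻ x, ‖kde K b Z N ω x‖ₑ ≤ ∫⁻ u, ‖K u‖ₑ := by
  have h_meas (k : ℕ) : Measurable fun x => ‖scaledKernel K b (Z k ω) x‖ₑ :=
    ((measurable_scaledKernel hKm b).comp measurable_prodMk_left).enorm
  calc ∫⁻ x, ‖kde K b Z N ω x‖ₑ
      ≤ ∫⁻ x, ‖1 / (N : ℝ)‖ₑ * ∑ k ∈ Finset.range N, ‖scaledKernel K b (Z k ω) x‖ₑ := by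
        gcongr with x
        rw [kde, enorm_mul]
        gcongr
        exact enorm_sum_le _ _
    _ = ‖1 / (N : ℝ)‖ₑ * (N * ∫⁻ u, ‖K u‖ₑ) := by
        rw [lintegral_const_mul' _ _ enorm_ne_top, lintegral_finsetSum _ fun k _ => h_meas k]
        simp only [lintegral_enorm_scaledKernel hKm hb, Finset.sum_const, Finset.card_range,
          nsmul_eq_mul]
    _ ≤ ∫⁻ u, ‖K u‖ₑ := by
        rw [← mul_assoc]
        refine mul_le_of_le_one_left zero_le ?_
        rw [Real.enorm_of_nonneg (by positivity), ← ENNReal.ofReal_natCast,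
          ← ENNReal.ofReal_mul (by positivity)]
        exact ENNReal.ofReal_le_one.2 (by rw [one_div]; exact inv_mul_le_one)

theorem kde_congr_ae (hK : K =ᵐ[volume] K') (hb : 0 < b) (N : ℕ) (ω : Ω) :
    kde K b Z N ω =ᵐ[volume] kde K' b Z N ω := by
  have h_smul : Measure.QuasiMeasurePreserving (fun x : EuclideanSpace ℝ (Fin d) => b⁻¹ • x)
      volume volume := by
    refine ⟨measurable_const_smul _, ?_⟩
    rw [Measure.map_addHaar_smul _ (inv_ne_zero hb.ne')]
    exact Measure.smul_absolutelyContinuous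
  have h_kernel (k : ℕ) : ∀ᵐ x, K (b⁻¹ • (Z k ω - x)) = K' (b⁻¹ • (Z k ω - x)) :=
    (h_smul.comp (Measure.measurePreserving_sub_left volume (Z k ω)).quasiMeasurePreserving).ae hK
  filter_upwards [ae_all_iff.2 h_kernel] with x hx
  simp only [kde, scaledKernel, hx]

theorem measurable_smoothing (hKm : Measurable K) (hpm : Measurable p) (b : ℝ) :
    Measurable (smoothing K p b) :=
  (StronglyMeasurable.integral_prod_right' (f := fun z : EuclideanSpace ℝ (Fin d) ×
    EuclideanSpace ℝ (Fin d) => K z.2 * p (z.1 + b • z.2))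
    (Measurable.stronglyMeasurable (by fun_prop))).measurable

theorem ofReal_mul_add_ofReal_mul_le {A B s t : ℝ} (hA : 0 ≤ A) (hB : 0 ≤ B) (hs : 0 ≤ s)
    (ht : 0 ≤ t) :
    ENNReal.ofReal (A * s) + ENNReal.ofReal (B * t) ≤ ENNReal.ofReal ((A + B) * (s + t)) := by
  rw [← ENNReal.ofReal_add (by positivity) (by positivity)]
  exact ENNReal.ofReal_le_ofReal (by nlinarith [mul_nonneg hA ht, mul_nonneg hB hs])

variable [MeasurableSpace Ω]

theorem measurable_kde (hKm : Measurable K) (hZ : ∀ k, Measurable (Z k)) (b : ℝ) (N : ℕ) :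
    Measurable fun z : Ω × EuclideanSpace ℝ (Fin d) => kde K b Z N z.1 z.2 := by
  unfold kde
  refine Measurable.const_mul (Finset.measurable_fun_sum _ fun k _ => ?_) _
  exact (measurable_scaledKernel hKm b).comp
    (((hZ k).comp measurable_fst).prodMk measurable_snd)

variable {μ : Measure Ω} [IsProbabilityMeasure μ]

theorem sq_lintegral_lintegral_le {α : Type*} [MeasurableSpace α] {ν : Measure α}
    {f : Ω × α → ℝ≥0∞} {w : α → ℝ≥0∞} (hf : Measurable f) (hw : Measurable w)
    (hw0 : ∀ x, w x ≠ 0) (hw_top : ∀ x, w x ≠ ∞) :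
    (∫⁻ x, ∫⁻ ω, f (ω, x) ∂μ ∂ν) ^ 2 ≤
      (∫⁻ x, (w x)⁻¹ ∂ν) * ∫⁻ x, w x * ∫⁻ ω, f (ω, x) ^ 2 ∂μ ∂ν := by
  refine (sq_lintegral_le_lintegral_inv_mul hf.lintegral_prod_left' hw hw0 hw_top).trans ?_
  gcongr with x
  have h_meas : Measurable fun ω => f (ω, x) := hf.comp measurable_prodMk_right
  simpa only [measure_univ, one_mul] using sq_lintegral_le (ν := μ) h_meas

theorem HasLinearVariance.lintegral_ofReal_density
    (hZ : HasLinearVariance μ (volume.withDensity fun x => ENNReal.ofReal (p x)) Z) :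
    ∫⁻ x, ENNReal.ofReal (p x) = 1 := by
  have := hZ.isProbabilityMeasure
  rw [← setLIntegral_univ, ← withDensity_apply _ MeasurableSet.univ, measure_univ]

theorem HasLinearVariance.exists_lintegral_enorm_kde_sub_smoothing_sq_le
    (hZ : HasLinearVariance μ (volume.withDensity fun x => ENNReal.ofReal (p x)) Z)
    (hp : 0 ≤ᵐ[volume] p) (hKm : Measurable K) (hpm : Measurable p) :
    ∃ C : ℝ, 0 < C ∧ ∀ N : ℕ, 0 < N → ∀ b : ℝ, 0 < b → ∀ x,
      ∫⁻ ω, ‖kde K b Z N ω x - smoothing K p b x‖ₑ ^ 2 ∂μ ≤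
        ENNReal.ofReal (C * (1 / (N * b ^ d))) * sqSmoothing K p b x := by
  obtain ⟨C, hC0, hC⟩ := hZ.exists_lintegral_enorm_average_sub_sq_le
  refine ⟨C, hC0, fun N hN b hb x => ?_⟩
  have h := hC (fun z => scaledKernel K b z x)
    ((measurable_scaledKernel hKm b).comp measurable_prodMk_right) N hN
  rw [integral_scaledKernel hp hpm hb, lintegral_enorm_scaledKernel_sq hKm hpm hb, ← mul_assoc,
    ← ENNReal.ofReal_mul (by positivity), div_mul_div_comm, mul_one,
    div_eq_mul_one_div C] at h
  exact h

theorem HasLinearVariance.exists_lintegral_lintegral_enorm_kde_sub_smoothing_sq_le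
    (hZ : HasLinearVariance μ (volume.withDensity fun x => ENNReal.ofReal (p x)) Z)
    (hp : 0 ≤ᵐ[volume] p) (hKm : Measurable K) (hK2 : MemLp K 2 volume) (hpm : Measurable p) :
    ∃ B : ℝ, 0 ≤ B ∧ ∀ N : ℕ, 0 < N → ∀ b : ℝ, 0 < b →
      ∫⁻ x, ∫⁻ ω, ‖kde K b Z N ω x - smoothing K p b x‖ₑ ^ 2 ∂μ ∂volume ≤
        ENNReal.ofReal (B * (1 / (N * b ^ d))) := by
  obtain ⟨C, hC0, hC⟩ := hZ.exists_lintegral_enorm_kde_sub_smoothing_sq_le hp hKm hpm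
  have : 0 ≤ ∫ u, K u ^ 2 := integral_nonneg fun u => sq_nonneg _
  refine ⟨C * ∫ u, K u ^ 2, by positivity, fun N hN b hb => ?_⟩
  calc ∫⁻ x, ∫⁻ ω, ‖kde K b Z N ω x - smoothing K p b x‖ₑ ^ 2 ∂μ ∂volume
      ≤ ∫⁻ x, ENNReal.ofReal (C * (1 / (N * b ^ d))) * sqSmoothing K p b x :=
        lintegral_mono (hC N hN b hb)
    _ = ENNReal.ofReal (C * (1 / (N * b ^ d))) * ENNReal.ofReal (∫ u, K u ^ 2) := by
        rw [lintegral_const_mul' _ _ ENNReal.ofReal_ne_top, lintegral_sqSmoothing hKm hpm,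
          hZ.lintegral_ofReal_density, mul_one, lintegral_enorm_sq_eq_ofReal_integral hK2]
    _ = ENNReal.ofReal (C * (∫ u, K u ^ 2) * (1 / (N * b ^ d))) := by
        rw [← ENNReal.ofReal_mul (by positivity), mul_right_comm]

theorem HasLinearVariance.exists_sq_lintegral_lintegral_enorm_kde_sub_smoothing_le
    (hZ : HasLinearVariance μ (volume.withDensity fun x => ENNReal.ofReal (p x)) Z)
    (hp : 0 ≤ᵐ[volume] p) (hKm : Measurable K) (hpm : Measurable p) {s : ℝ} (hs : 0 ≤ s) :
    ∃ C : ℝ, 0 < C ∧ ∀ N : ℕ, 0 < N → ∀ b : ℝ, 0 < b → b ≤ 1 →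
      (∫⁻ x, ∫⁻ ω, ‖kde K b Z N ω x - smoothing K p b x‖ₑ ∂μ ∂volume) ^ 2 ≤
        ENNReal.ofReal (C * (1 / (N * b ^ d))) *
          ((∫⁻ x : EuclideanSpace ℝ (Fin d), polyWeight (-s) x) *
            ((∫⁻ u, polyWeight s u * ‖K u‖ₑ ^ 2) *
              ∫⁻ x, polyWeight s x * ENNReal.ofReal (p x))) := by
  obtain ⟨C, hC0, hC⟩ := hZ.exists_lintegral_enorm_kde_sub_smoothing_sq_le hp hKm hpm
  refine ⟨C, hC0, fun N hN b hb hb1 => ?_⟩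
  have h_meas : Measurable fun z : Ω × EuclideanSpace ℝ (Fin d) =>
      ‖kde K b Z N z.1 z.2 - smoothing K p b z.2‖ₑ :=
    ((measurable_kde hKm (fun k => (hZ.measurePreserving k).measurable) b N).sub
      ((measurable_smoothing hKm hpm b).comp measurable_snd)).enorm
  calc (∫⁻ x, ∫⁻ ω, ‖kde K b Z N ω x - smoothing K p b x‖ₑ ∂μ ∂volume) ^ 2
      ≤ (∫⁻ x : EuclideanSpace ℝ (Fin d), (polyWeight s x)⁻¹) *
          ∫⁻ x, polyWeight s x *
            ∫⁻ ω, ‖kde K b Z N ω x - smoothing K p b x‖ₑ ^ 2 ∂μ ∂volume :=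
        sq_lintegral_lintegral_le h_meas measurable_polyWeight
          (fun x => (ENNReal.ofReal_pos.2 (by positivity)).ne') fun x => ENNReal.ofReal_ne_top
    _ ≤ (∫⁻ x : EuclideanSpace ℝ (Fin d), polyWeight (-s) x) * ∫⁻ x,
          ENNReal.ofReal (C * (1 / (N * b ^ d))) * (polyWeight s x * sqSmoothing K p b x) := by
        simp only [inv_polyWeight, mul_left_comm (ENNReal.ofReal _)]
        gcongr with x
        exact hC N hN b hb x
    _ ≤ _ := by
        rw [lintegral_const_mul' _ _ ENNReal.ofReal_ne_top, mul_left_comm]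
        gcongr
        exact lintegral_polyWeight_mul_sqSmoothing_le hKm hpm hs (abs_le.2 ⟨by linarith, hb1⟩)

theorem HasLinearVariance.exists_lintegral_lintegral_enorm_kde_sub_smoothing_le
    (hZ : HasLinearVariance μ (volume.withDensity fun x => ENNReal.ofReal (p x)) Z)
    (hp : 0 ≤ᵐ[volume] p) (hKm : Measurable K) (hpm : Measurable p) {s : ℝ} (hs : (d : ℝ) < s)
    (hKs : ∫⁻ u, polyWeight s u * ‖K u‖ₑ ^ 2 ≠ ∞)
    (hps : ∫⁻ x, polyWeight s x * ENNReal.ofReal (p x) ≠ ∞) :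
    ∃ B : ℝ, 0 ≤ B ∧ ∀ N : ℕ, 0 < N → ∀ b : ℝ, 0 < b → b ≤ 1 →
      ∫⁻ x, ∫⁻ ω, ‖kde K b Z N ω x - smoothing K p b x‖ₑ ∂μ ∂volume ≤
        ENNReal.ofReal (B * (1 / √(N * b ^ d))) := by
  obtain ⟨C, hC0, hC⟩ := hZ.exists_sq_lintegral_lintegral_enorm_kde_sub_smoothing_le hp hKm hpm
    ((Nat.cast_nonneg d).trans hs.le)
  have h_top := ENNReal.mul_ne_top (lintegral_polyWeight_neg_ne_top hs)
    (ENNReal.mul_ne_top hKs hps)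
  generalize (∫⁻ x : EuclideanSpace ℝ (Fin d), polyWeight (-s) x) * _ = T at hC h_top
  have : 0 ≤ T.toReal := ENNReal.toReal_nonneg
  refine ⟨√(C * T.toReal), Real.sqrt_nonneg _, fun N hN b hb hb1 => ?_⟩
  rw [← ENNReal.pow_le_pow_left_iff two_ne_zero]
  refine (hC N hN b hb hb1).trans_eq ?_
  rw [← ENNReal.ofReal_pow (by positivity), mul_pow, div_pow, one_pow,
    Real.sq_sqrt (by positivity), Real.sq_sqrt (by positivity), mul_right_comm,
    ENNReal.ofReal_mul (q := T.toReal) (by positivity), ENNReal.ofReal_toReal h_top]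

theorem HasLinearVariance.exists_MISE_kde_le_of_measurable
    (hZ : HasLinearVariance μ (volume.withDensity fun x => ENNReal.ofReal (p x)) Z)
    (hp : 0 ≤ᵐ[volume] p) (hKm : Measurable K) (hpm : Measurable p)
    (hK : IsSecondOrderKernel K) (hK2 : MemLp K 2 volume) (hp1 : MemSobolev 2 1 p)
    (hp2 : MemSobolev 2 2 p) :
    ∃ C : ℝ, ∀ N : ℕ, 0 < N → ∀ b : ℝ, 0 < b →
      MISE μ (kde K b Z N) p ≤ ENNReal.ofReal (C * (1 / (N * b ^ d) + b ^ 4)) := by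
  obtain ⟨B, hB0, hB⟩ :=
    hZ.exists_lintegral_lintegral_enorm_kde_sub_smoothing_sq_le hp hKm hK2 hpm
  obtain ⟨A, hA0, hA⟩ := hK.exists_eLpNorm_smoothing_sub_le hKm hpm one_le_two
    ENNReal.ofNat_ne_top hp1 hp2
  refine ⟨2 * B + 2 * A ^ 2, fun N hN b hb => ?_⟩
  have h_bias : ∫⁻ x, ‖smoothing K p b x - p x‖ₑ ^ 2 ≤ ENNReal.ofReal (A ^ 2 * b ^ 4) := by
    have h_sq := pow_le_pow_left₀ zero_le (hA b) 2
    rw [← ENNReal.ofReal_pow (by positivity), mul_pow, ← pow_mul] at h_sq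
    refine le_of_eq_of_le ?_ h_sq
    simpa using (eLpNorm_nnreal_pow_eq_lintegral (p := 2) two_ne_zero).symm
  calc MISE μ (kde K b Z N) p
      ≤ 2 * (∫⁻ x, ∫⁻ ω, ‖kde K b Z N ω x - smoothing K p b x‖ₑ ^ 2 ∂μ ∂volume) +
          2 * ∫⁻ x, ‖smoothing K p b x - p x‖ₑ ^ 2 :=
        MISE_le_add (measurable_kde hKm (fun k => (hZ.measurePreserving k).measurable) b N)
          (measurable_smoothing hKm hpm b) hpm
    _ ≤ 2 * ENNReal.ofReal (B * (1 / (N * b ^ d))) + 2 * ENNReal.ofReal (A ^ 2 * b ^ 4) := by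
        gcongr
        exact hB N hN b hb
    _ = ENNReal.ofReal (2 * B * (1 / (N * b ^ d))) + ENNReal.ofReal (2 * A ^ 2 * b ^ 4) := by
        simp only [mul_assoc, ENNReal.ofReal_mul zero_le_two, ENNReal.ofReal_ofNat]
    _ ≤ _ := ofReal_mul_add_ofReal_mul_le (by positivity) (by positivity) (by positivity)
        (by positivity)

theorem HasLinearVariance.exists_MIAE_kde_le_of_measurable_of_le_one
    (hZ : HasLinearVariance μ (volume.withDensity fun x => ENNReal.ofReal (p x)) Z)
    (hp : 0 ≤ᵐ[volume] p) (hKm : Measurable K) (hpm : Measurable p)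
    (hK : IsSecondOrderKernel K) (hp1 : MemSobolev 2 1 p) {s : ℝ} (hs : (d : ℝ) < s)
    (hKs : ∫⁻ u, polyWeight s u * ‖K u‖ₑ ^ 2 ≠ ∞)
    (hps : ∫⁻ x, polyWeight s x * ENNReal.ofReal (p x) ≠ ∞) :
    ∃ C : ℝ, 0 ≤ C ∧ ∀ N : ℕ, 0 < N → ∀ b : ℝ, 0 < b → b ≤ 1 →
      MIAE μ (kde K b Z N) p ≤ ENNReal.ofReal (C * (1 / √(N * b ^ d) + b ^ 2)) := by
  obtain ⟨B, hB0, hB⟩ :=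
    hZ.exists_lintegral_lintegral_enorm_kde_sub_smoothing_le hp hKm hpm hs hKs hps
  obtain ⟨A, hA0, hA⟩ := hK.exists_eLpNorm_smoothing_sub_le hKm hpm le_rfl ENNReal.one_ne_top
    hp1 hp1
  refine ⟨B + A, by positivity, fun N hN b hb hb1 => ?_⟩
  calc MIAE μ (kde K b Z N) p
      ≤ (∫⁻ x, ∫⁻ ω, ‖kde K b Z N ω x - smoothing K p b x‖ₑ ∂μ ∂volume) +
          ∫⁻ x, ‖smoothing K p b x - p x‖ₑ :=
        MIAE_le_add (measurable_kde hKm (fun k => (hZ.measurePreserving k).measurable) b N)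
          (measurable_smoothing hKm hpm b) hpm
    _ ≤ ENNReal.ofReal (B * (1 / √(N * b ^ d))) + ENNReal.ofReal (A * b ^ 2) := by
        rw [← eLpNorm_one_eq_lintegral_enorm]
        exact add_le_add (hB N hN b hb hb1) (hA b)
    _ ≤ _ := ofReal_mul_add_ofReal_mul_le hB0 hA0 (by positivity) (by positivity)

theorem HasLinearVariance.MIAE_kde_le_lintegral_add_one
    (hZ : HasLinearVariance μ (volume.withDensity fun x => ENNReal.ofReal (p x)) Z)
    (hp : 0 ≤ᵐ[volume] p) (hKm : Measurable K) (hpm : Measurable p) (hb : 0 < b) :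
    MIAE μ (kde K b Z N) p ≤ (∫⁻ u, ‖K u‖ₑ) + 1 := by
  have h_density : ∫⁻ x, ‖p x‖ₑ = 1 := by
    rw [← hZ.lintegral_ofReal_density]
    exact lintegral_congr_ae (hp.mono fun x hx => Real.enorm_of_nonneg hx)
  rw [MIAE_eq_lintegral_enorm]
  calc ∫⁻ ω, ∫⁻ x, ‖kde K b Z N ω x - p x‖ₑ ∂volume ∂μ
      ≤ ∫⁻ ω, ((∫⁻ u, ‖K u‖ₑ) + 1) ∂μ := by
        refine lintegral_mono fun ω => ?_
        calc ∫⁻ x, ‖kde K b Z N ω x - p x‖ₑ ≤ ∫⁻ x, (‖kde K b Z N ω x‖ₑ + ‖p x‖ₑ) :=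
              lintegral_mono fun x => enorm_sub_le
          _ = (∫⁻ x, ‖kde K b Z N ω x‖ₑ) + 1 := by
              rw [lintegral_add_right _ hpm.enorm, h_density]
          _ ≤ _ := by
              exact add_le_add_left (lintegral_enorm_kde_le hKm hb ω) 1
    _ = (∫⁻ u, ‖K u‖ₑ) + 1 := by rw [lintegral_const, measure_univ, mul_one]

theorem HasLinearVariance.exists_MIAE_kde_le_of_measurable
    (hZ : HasLinearVariance μ (volume.withDensity fun x => ENNReal.ofReal (p x)) Z)
    (hp : 0 ≤ᵐ[volume] p) (hKm : Measurable K) (hpm : Measurable p)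
    (hK : IsSecondOrderKernel K) (hp1 : MemSobolev 2 1 p) {s : ℝ} (hs : (d : ℝ) < s)
    (hKs : ∫⁻ u, polyWeight s u * ‖K u‖ₑ ^ 2 ≠ ∞)
    (hps : ∫⁻ x, polyWeight s x * ENNReal.ofReal (p x) ≠ ∞) :
    ∃ C : ℝ, ∀ N : ℕ, 0 < N → ∀ b : ℝ, 0 < b →
      MIAE μ (kde K b Z N) p ≤ ENNReal.ofReal (C * (1 / √(N * b ^ d) + b ^ 2)) := by
  obtain ⟨C, hC0, hC⟩ :=
    hZ.exists_MIAE_kde_le_of_measurable_of_le_one hp hKm hpm hK hp1 hs hKs hps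
  have hK_norm : 0 ≤ ∫ u, ‖K u‖ := integral_nonneg fun u => norm_nonneg _
  refine ⟨C + ((∫ u, ‖K u‖) + 1), fun N hN b hb => ?_⟩
  have h_inv : 0 ≤ 1 / √(N * b ^ d) := by positivity
  rcases le_total b 1 with hb1 | hb1
  · refine (hC N hN b hb hb1).trans (ENNReal.ofReal_le_ofReal ?_)
    gcongr
    linarith
  · calc MIAE μ (kde K b Z N) p ≤ (∫⁻ u, ‖K u‖ₑ) + 1 :=
          hZ.MIAE_kde_le_lintegral_add_one hp hKm hpm hb
      _ = ENNReal.ofReal ((∫ u, ‖K u‖) + 1) := by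
          rw [ENNReal.ofReal_add hK_norm zero_le_one, ENNReal.ofReal_one,
            ofReal_integral_norm_eq_lintegral_enorm hK.integrable]
      _ ≤ _ := by
          refine ENNReal.ofReal_le_ofReal ?_
          nlinarith [one_le_pow₀ hb1 (n := 2), mul_nonneg hC0 (add_nonneg h_inv (sq_nonneg b))]

end Errors

/-! ### Reduction to measurable kernels and densities -/

section Reduction

variable {d : ℕ} {K K' p p' : EuclideanSpace ℝ (Fin d) → ℝ}

theorem MemSobolev.congr_ae {k : ℕ} {q : ℝ≥0∞} (hp : MemSobolev k q p) (hpp : p =ᵐ[volume] p') :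
    MemSobolev k q p' := by
  refine ⟨hp.1.ae_eq hpp, fun n hn a => ?_⟩
  obtain ⟨g, hg, hgφ⟩ := hp.2 n hn a
  refine ⟨g, hg, fun φ hφ hφ_supp => ?_⟩
  rw [← hgφ φ hφ hφ_supp]
  refine integral_congr_ae ?_
  filter_upwards [hpp] with x hx
  rw [hx]

theorem IsSecondOrderKernel.congr_ae (hK : IsSecondOrderKernel K) (hKK : K =ᵐ[volume] K') :
    IsSecondOrderKernel K' where
  integrable := hK.integrable.congr hKK
  integral_eq_one := by rw [← hK.integral_eq_one, integral_congr_ae hKK]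
  integral_smul_eq_zero := by
    rw [← hK.integral_smul_eq_zero]
    exact integral_congr_ae (hKK.mono fun u hu => by simp only [hu])
  integrable_sq_norm_mul_abs :=
    hK.integrable_sq_norm_mul_abs.congr (hKK.mono fun u hu => by simp only [hu])

variable {Ω : Type*} [MeasurableSpace Ω] {μ : Measure Ω}
  {Z : ℕ → Ω → EuclideanSpace ℝ (Fin d)}

theorem HasLinearVariance.congr_density
    (hZ : HasLinearVariance μ (volume.withDensity fun x => ENNReal.ofReal (p x)) Z)
    (hpp : p =ᵐ[volume] p') :
    HasLinearVariance μ (volume.withDensity fun x => ENNReal.ofReal (p' x)) Z := by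
  have h_density : (fun x => ENNReal.ofReal (p x)) =ᵐ[volume] fun x => ENNReal.ofReal (p' x) :=
    hpp.fun_comp ENNReal.ofReal
  rwa [withDensity_congr_ae h_density] at hZ

variable [IsProbabilityMeasure μ]

theorem HasLinearVariance.exists_MISE_kde_le
    (hZ : HasLinearVariance μ (volume.withDensity fun x => ENNReal.ofReal (p x)) Z)
    (hp : 0 ≤ᵐ[volume] p) (hK : IsSecondOrderKernel K) (hK2 : MemLp K 2 volume)
    (hp1 : MemSobolev 2 1 p) (hp2 : MemSobolev 2 2 p) :
    ∃ C : ℝ, ∀ N : ℕ, 0 < N → ∀ b : ℝ, 0 < b →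
      MISE μ (kde K b Z N) p ≤ ENNReal.ofReal (C * (1 / (N * b ^ d) + b ^ 4)) := by
  obtain ⟨K', hK'm, hKK'⟩ := hK.integrable.aemeasurable
  obtain ⟨p', hp'm, hpp'⟩ := hp1.1.aemeasurable
  obtain ⟨C, hC⟩ := (hZ.congr_density hpp').exists_MISE_kde_le_of_measurable
    (hp.trans_eq hpp') hK'm hp'm (hK.congr_ae hKK') (hK2.ae_eq hKK') (hp1.congr_ae hpp')
    (hp2.congr_ae hpp')
  refine ⟨C, fun N hN b hb => ?_⟩
  rw [MISE_congr_ae (kde_congr_ae hKK' hb N) hpp']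
  exact hC N hN b hb

theorem HasLinearVariance.exists_MIAE_kde_le
    (hZ : HasLinearVariance μ (volume.withDensity fun x => ENNReal.ofReal (p x)) Z)
    (hp : 0 ≤ᵐ[volume] p) (hK : IsSecondOrderKernel K) (hp1 : MemSobolev 2 1 p)
    {s : ℝ} (hs : (d : ℝ) < s) (hKs : ∫⁻ u, polyWeight s u * ‖K u‖ₑ ^ 2 ≠ ∞)
    (hps : ∫⁻ x, polyWeight s x * ENNReal.ofReal (p x) ≠ ∞) :
    ∃ C : ℝ, ∀ N : ℕ, 0 < N → ∀ b : ℝ, 0 < b →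
      MIAE μ (kde K b Z N) p ≤ ENNReal.ofReal (C * (1 / √(N * b ^ d) + b ^ 2)) := by
  obtain ⟨K', hK'm, hKK'⟩ := hK.integrable.aemeasurable
  obtain ⟨p', hp'm, hpp'⟩ := hp1.1.aemeasurable
  rw [lintegral_congr_ae (hKK'.mono fun u hu => by rw [hu])] at hKs
  rw [lintegral_congr_ae (hpp'.mono fun x hx => by rw [hx])] at hps
  obtain ⟨C, hC⟩ := (hZ.congr_density hpp').exists_MIAE_kde_le_of_measurable
    (hp.trans_eq hpp') hK'm hp'm (hK.congr_ae hKK') (hp1.congr_ae hpp') hs hKs hps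
  refine ⟨C, fun N hN b hb => ?_⟩
  rw [MIAE_congr_ae (kde_congr_ae hKK' hb N) hpp']
  exact hC N hN b hb

theorem TailCondition.exists_lintegral_polyWeight_ne_top (hT : TailCondition K p) :
    ∃ s : ℝ, (d : ℝ) < s ∧ ∫⁻ u, polyWeight s u * ‖K u‖ₑ ^ 2 ≠ ∞ ∧
      ∫⁻ x, polyWeight s x * ENNReal.ofReal (p x) ≠ ∞ := by
  obtain ⟨C, m, -, hm, hKm, hpm⟩ := hT
  refine ⟨m / 2, by linarith, ?_, lintegral_polyWeight_mul_ne_top (by linarith) (ae_of_all _ hpm)⟩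
  have : 0 ≤ m := by linarith [d.cast_nonneg (α := ℝ)]
  refine ne_top_of_le_ne_top hKm.lintegral_lt_top.ne (lintegral_mono fun u => ?_)
  rw [polyWeight, ← enorm_pow, Real.enorm_of_nonneg (sq_nonneg _),
    ← ENNReal.ofReal_mul (by positivity)]
  gcongr
  · linarith [norm_nonneg u]
  · linarith

variable {h : ℕ → ℝ}

theorem HasLinearVariance.isBigOSeq_MISE_kde
    (hZ : HasLinearVariance μ (volume.withDensity fun x => ENNReal.ofReal (p x)) Z)
    (hp : 0 ≤ᵐ[volume] p) (hK : IsSecondOrderKernel K) (hK2 : MemLp K 2 volume)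
    (hp1 : MemSobolev 2 1 p) (hp2 : MemSobolev 2 2 p) (hh : ∀ N, 0 < h N) :
    IsBigOSeq (fun N => MISE μ (kde K (h N) Z N) p) (sqBound d h) := by
  obtain ⟨C, hC⟩ := hZ.exists_MISE_kde_le hp hK hK2 hp1 hp2
  exact ⟨C, (eventually_gt_atTop 0).mono fun N hN => hC N hN (h N) (hh N)⟩

theorem HasLinearVariance.isBigOSeq_MIAE_kde
    (hZ : HasLinearVariance μ (volume.withDensity fun x => ENNReal.ofReal (p x)) Z)
    (hp : 0 ≤ᵐ[volume] p) (hK : IsSecondOrderKernel K) (hp1 : MemSobolev 2 1 p)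
    (hT : TailCondition K p) (hh : ∀ N, 0 < h N) :
    IsBigOSeq (fun N => MIAE μ (kde K (h N) Z N) p) (absBound d h) := by
  obtain ⟨s, hs, hKs, hps⟩ := hT.exists_lintegral_polyWeight_ne_top
  obtain ⟨C, hC⟩ := hZ.exists_MIAE_kde_le hp hK hp1 hs hKs hps
  exact ⟨C, (eventually_gt_atTop 0).mono fun N hN => hC N hN (h N) (hh N)⟩

end Reduction

end KDE

end

theorem mainTheorem9_general {Ω : Type*} [MeasurableSpace Ω] (μ : Measure Ω)
    [IsProbabilityMeasure μ] {d : ℕ} (hd : 0 < d)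
    (p : EuclideanSpace ℝ (Fin d) → ℝ) (hp : 0 ≤ᵐ[volume] p)
    (hp1 : KDE.MemSobolev 2 1 p) (hp2 : KDE.MemSobolev 2 2 p)
    (K : EuclideanSpace ℝ (Fin d) → ℝ) (hK : KDE.IsSecondOrderKernel K) (hK2 : MemLp K 2 volume)
    (h : ℕ → ℝ) (h_pos : ∀ N, 0 < h N) (Z : ℕ → Ω → EuclideanSpace ℝ (Fin d))
    (hZ : KDE.HasLinearVariance μ (volume.withDensity fun x => ENNReal.ofReal (p x)) Z) :
    (KDE.TailCondition K p →
      KDE.IsBigOSeq (fun N => KDE.MIAE μ (KDE.kde K (h N) Z N) p) (KDE.absBound d h)) ∧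
    KDE.IsBigOSeq (fun N => KDE.MISE μ (KDE.kde K (h N) Z N) p) (KDE.sqBound d h) ∧
    ((h =Θ[atTop] fun N : ℕ => (N : ℝ) ^ (-(1 : ℝ) / (d + 4))) →
      (KDE.TailCondition K p →
        KDE.IsBigOSeq (fun N => KDE.MIAE μ (KDE.kde K (h N) Z N) p)
          (fun N => (N : ℝ) ^ (-(2 : ℝ) / (d + 4)))) ∧
      KDE.IsBigOSeq (fun N => KDE.MISE μ (KDE.kde K (h N) Z N) p)
        (fun N => (N : ℝ) ^ (-(4 : ℝ) / (d + 4)))) ∧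
    (∀ b : ℕ → ℝ, (∀ N, 0 < b N) →
      ((fun N : ℕ => (N : ℝ) ^ (-(2 : ℝ) / (d + 4))) =O[atTop] KDE.absBound d b) ∧
      ((fun N : ℕ => (N : ℝ) ^ (-(4 : ℝ) / (d + 4))) =O[atTop] KDE.sqBound d b) ∧
      ((KDE.absBound d b =O[atTop] fun N : ℕ => (N : ℝ) ^ (-(2 : ℝ) / (d + 4))) ↔
        b =Θ[atTop] fun N : ℕ => (N : ℝ) ^ (-(1 : ℝ) / (d + 4))) ∧
      ((KDE.sqBound d b =O[atTop] fun N : ℕ => (N : ℝ) ^ (-(4 : ℝ) / (d + 4))) ↔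
        b =Θ[atTop] fun N : ℕ => (N : ℝ) ^ (-(1 : ℝ) / (d + 4)))) := by
  have h_two (N : ℕ) : (N : ℝ) ^ (-(2 : ℝ) / (d + 4)) = KDE.balancedBandwidth d N ^ 2 :=
    mod_cast (KDE.balancedBandwidth_pow d N 2).symm
  have h_four (N : ℕ) : (N : ℝ) ^ (-(4 : ℝ) / (d + 4)) = KDE.balancedBandwidth d N ^ 4 :=
    mod_cast (KDE.balancedBandwidth_pow d N 4).symm
  have h_MIAE := fun hT => hZ.isBigOSeq_MIAE_kde hp hK hp1 hT h_pos
  have h_MISE := hZ.isBigOSeq_MISE_kde hp hK hK2 hp1 hp2 h_pos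
  simp only [h_two, h_four]
  refine ⟨h_MIAE, h_MISE, fun hh => ⟨fun hT => ?_, ?_⟩, fun b hb => ⟨?_, ?_, ?_, ?_⟩⟩
  · exact (h_MIAE hT).trans_isBigO
      ((KDE.absBound_isBigO_balancedBandwidth_sq_iff h_pos hd).2 hh) fun N => sq_nonneg _
  · exact h_MISE.trans_isBigO
      ((KDE.sqBound_isBigO_balancedBandwidth_pow_four_iff h_pos hd).2 hh) fun N => by positivity
  · exact KDE.balancedBandwidth_sq_isBigO_absBound hb
  · exact KDE.balancedBandwidth_pow_four_isBigO_sqBound hb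
  · exact KDE.absBound_isBigO_balancedBandwidth_sq_iff hb hd
  · exact KDE.sqBound_isBigO_balancedBandwidth_pow_four_iff hb hd

theorem mainTheorem9 {Ω : Type*} [MeasurableSpace Ω] (μ : Measure Ω) [IsProbabilityMeasure μ]
    {d : ℕ} (hd : 0 < d)
    (P : Measure (EuclideanSpace ℝ (Fin d))) [IsProbabilityMeasure P]
    (p : EuclideanSpace ℝ (Fin d) → ℝ) (hp : ∀ x, 0 ≤ p x)
    (hP : P = volume.withDensity (fun x => ENNReal.ofReal (p x)))
    (K : EuclideanSpace ℝ (Fin d) → ℝ) (h : ℕ → ℝ) (hA : KDE.Assumptions K h p)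
    (Z : ℕ → Ω → EuclideanSpace ℝ (Fin d)) (hZ : KDE.IsIIDOrStationaryWithGap μ P Z) :
    -- error bounds for a general bandwidth
    (KDE.TailCondition K p →
      KDE.IsBigOSeq (fun N => KDE.MIAE μ (KDE.kde K (h N) Z N) p) (KDE.absBound d h)) ∧
    KDE.IsBigOSeq (fun N => KDE.MISE μ (KDE.kde K (h N) Z N) p) (KDE.sqBound d h) ∧
    -- rates for the balanced bandwidth
    ((h =Θ[atTop] fun N : ℕ => (N : ℝ) ^ (-(1 : ℝ) / (d + 4))) →
      (KDE.TailCondition K p →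
        KDE.IsBigOSeq (fun N => KDE.MIAE μ (KDE.kde K (h N) Z N) p)
          (fun N => (N : ℝ) ^ (-(2 : ℝ) / (d + 4)))) ∧
      KDE.IsBigOSeq (fun N => KDE.MISE μ (KDE.kde K (h N) Z N) p)
        (fun N => (N : ℝ) ^ (-(4 : ℝ) / (d + 4)))) ∧
    -- optimality of the balanced bandwidth: no bandwidth gives bounds of smaller order, and
    -- exactly the bandwidths of order `N ^ (-1 / (d + 4))` attain this order
    (∀ b : ℕ → ℝ, (∀ N, 0 < b N) →
      ((fun N : ℕ => (N : ℝ) ^ (-(2 : ℝ) / (d + 4))) =O[atTop] KDE.absBound d b) ∧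
      ((fun N : ℕ => (N : ℝ) ^ (-(4 : ℝ) / (d + 4))) =O[atTop] KDE.sqBound d b) ∧
      ((KDE.absBound d b =O[atTop] fun N : ℕ => (N : ℝ) ^ (-(2 : ℝ) / (d + 4))) ↔
        b =Θ[atTop] fun N : ℕ => (N : ℝ) ^ (-(1 : ℝ) / (d + 4))) ∧
      ((KDE.sqBound d b =O[atTop] fun N : ℕ => (N : ℝ) ^ (-(4 : ℝ) / (d + 4))) ↔
        b =Θ[atTop] fun N : ℕ => (N : ℝ) ^ (-(1 : ℝ) / (d + 4)))) := by
  subst hP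
  exact mainTheorem9_general μ hd p (ae_of_all _ hp) hA.p_sobolev_one hA.p_sobolev_two K
    ⟨memLp_one_iff_integrable.1 hA.K_L1, hA.K_mass, hA.K_first_moment, hA.K_second_moment⟩ hA.K_L2
    h hA.h_pos Z hZ.hasLinearVariance
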